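/- **Theorem (Gradient estimate).** Let $\Omega\subset\mathbb{C}$ be the open unit disc, $\Gamma=\partial\Omega$ the unit circle, $\partial=\frac12(\partial_x-i\partial_y)$ and $\overline\partial=\frac12(\partial_x+i\partial_y)$ (weak derivatives). For sequences ${\bf u}=\langle u_0,u_{-1},u_{-2},\dots\rangle$ of complex valued functions on $\Omega$, for $p\in\{0,\frac12,1\}$ and $q\in\{0,1\}$, put $$\|{\bf u}\|_{p,q}^2=\sum_{j=0}^\infty(1+j^2)^p\,\|u_{-j}\|_{H^q(\Omega)}^2,\qquad \|{\bf u}\|:=\|{\bf u}\|_{0,0},$$ where $\|u\|_{H^0}=\|u\|_{L^2(\Omega)}$ and $\|u\|_{H^1(\Omega)}^2=\|u\|_{L^2}^2+\|\partial_xu\|_{L^2}^2+\|\partial_yu\|_{L^2}^2$, and let $l^{2,p}(\mathbb{N};H^q(\Omega))$ be the space of the sequences for which this is finite, with $l^2=l^{2,0}$. For sequences ${\bf g}=\langle g_0,g_{-1},\dots\rangle$ of functions on $\Gamma$ with Fourier expansions $g_{-j}(e^{i\beta})=\sum_{k\in\mathbb{Z}}g_{-j,k}e^{ik\beta}$, put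 $$\|{\bf g}\|_{p,\frac12}^2=\sum_{j=0}^\infty\sum_{k\in\mathbb{Z}}(1+j^2)^p(1+k^2)^{\frac12}|g_{-j,k}|^2 .$$ Let $L\langle u_0,u_{-1},\dots\rangle=\langle u_{-1},u_{-2},\dots\rangle$, and let ${\bf u}|_\Gamma$ be the componentwise trace. There are constants $\mu$ for which the Poincaré inequality $$\|{\bf u}\|^2\le\mu\left(\|\partial{\bf u}\|^2+\|{\bf u}|_\Gamma\|_{0,\frac12}^2\right)\qquad\text{for all }{\bf u}\in l^2(\mathbb{N};H^1(\Omega))$$ holds. Let $\mu$ be any such constant. Let ${\bf f}\in l^{2,1}(\mathbb{N};L^2(\Omega))$, and let $B$ be a linear operator that maps $l^2(\mathbb{N};L^2(\Omega))$ to $l^{2,1}(\mathbb{N};L^2(\Omega))$ and $l^2(\mathbb{N};H^1(\Omega))$ to $l^{2,1}(\mathbb{N};H^1(\Omega))$, with a constant $C_B>0$ such that $$\|B{\bf w}\|_{1,0}\le C_B\|{\bf w}\|\ \ \forall\,{\bf w}\in l^2(\mathbb{N};L^2(\Omega)),\qquad \|B{\bf w}\|_{1,1}\le C_B\|{\bf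 w}\|_{0,1}\ \ \forall\,{\bf w}\in l^2(\mathbb{N};H^1(\Omega)),$$ and suppose that $\epsilon:=\sqrt{2\mu}\,C_B<\sqrt2-1$. If ${\bf v}\in l^{2,\frac12}(\mathbb{N};H^1(\Omega))$ is a solution of $$\overline\partial{\bf v}+L^2\partial{\bf v}=B{\bf v}+{\bf f}\quad\text{in }\Omega,$$ then the traces of its components exist and ${\bf v}|_\Gamma\in l^{2,\frac12}(\mathbb{N};H^{\frac12}(\Gamma))$ (that is, $\|{\bf v}|_\Gamma\|_{\frac12,\frac12}<\infty$), and $$0\le\|\partial{\bf v}\|\le\frac{b+\sqrt{b^2+4ac}}{2a},$$ where $$a=1-2\epsilon-\epsilon^2>0,\qquad b=2\epsilon\,\|{\bf v}|_\Gamma\|_{0,\frac12}+2\sqrt2\,\|{\bf f}\|_{1,0},$$ $$c=\epsilon^2\|{\bf v}|_\Gamma\|_{0,\frac12}^2+\pi\|{\bf v}|_\Gamma\|_{\frac12,\frac12}^2+2\|{\bf f}\|_{1,0}^2 .$$ -/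

import Mathlib

open MeasureTheory Filter Topology
open scoped ENNReal ContDiff

noncomputable section

namespace BukhgeimBeltrami

/-- The domain `Ω`: the open unit disc of `ℂ = ℝ²`. -/
def disc : Set ℂ := Metric.ball 0 1

/-- Lebesgue measure on `Ω`. -/
def discMeasure : Measure ℂ := volume.restrict disc

/-- `L²(Ω)`, complex valued. -/
abbrev L2 : Type := Lp ℂ 2 discMeasure

/-- `w` is the weak derivative of `u` on `Ω` in the direction `e` (the direction `1` is `∂ₓ`, the
direction `i` is `∂_y`). -/
def IsWeakDeriv (e : ℂ) (u w : L2) : Prop :=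
  ∀ φ : ℂ → ℂ, ContDiff ℝ ∞ φ → HasCompactSupport φ → tsupport φ ⊆ disc →
    ∫ z, u z * fderiv ℝ φ z e ∂discMeasure = - ∫ z, w z * φ z ∂discMeasure

/-- `u ∈ H¹(Ω)`. -/
def MemH1 (u : L2) : Prop :=
  (∃ w, IsWeakDeriv 1 u w) ∧ ∃ w, IsWeakDeriv Complex.I u w

open Classical in
/-- The weak derivative in the direction `e` (`0` where there is none in `L²(Ω)`). -/
def weakDeriv (e : ℂ) (u : L2) : L2 :=
  if h : ∃ w, IsWeakDeriv e u w then h.choose else 0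

/-- `∂ = (∂ₓ - i ∂_y) / 2`. -/
def del (u : L2) : L2 :=
  (1 / 2 : ℂ) • (weakDeriv 1 u - Complex.I • weakDeriv Complex.I u)

/-- `∂̄ = (∂ₓ + i ∂_y) / 2`. -/
def delbar (u : L2) : L2 :=
  (1 / 2 : ℂ) • (weakDeriv 1 u + Complex.I • weakDeriv Complex.I u)

/-- The square of the norm of `H¹(Ω)`. -/
def h1NormSq (u : L2) : ℝ :=
  ‖u‖ ^ 2 + ‖weakDeriv 1 u‖ ^ 2 + ‖weakDeriv Complex.I u‖ ^ 2

instance fact_two_pi_pos : Fact (0 < 2 * Real.pi) := ⟨Real.two_pi_pos⟩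

/-- `L²(Γ)` on the unit circle `Γ`, parametrised by the angle `β ∈ ℝ / 2πℤ`. -/
abbrev L2Circle : Type :=
  Lp ℂ 2 (AddCircle.haarAddCircle : Measure (AddCircle (2 * Real.pi)))

/-- The point `e^{iβ}` of `Γ`. -/
def circlePoint (β : AddCircle (2 * Real.pi)) : ℂ := (AddCircle.toCircle β : ℂ)

/-- `g` is the trace on `Γ` of `u ∈ H¹(Ω)`: some sequence of functions that are smooth up to the
boundary converges to `u` in `H¹(Ω)`, and their restrictions to `Γ` converge to `g` in `L²(Γ)`. -/
def IsTrace (u : L2) (g : L2Circle) : Prop :=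
  ∃ φ : ℕ → ℂ → ℂ, (∀ n, ContDiff ℝ ∞ (φ n)) ∧
    Tendsto (fun n => eLpNorm (fun z => φ n z - u z) 2 discMeasure) atTop (𝓝 0) ∧
    Tendsto (fun n => eLpNorm (fun z => fderiv ℝ (φ n) z 1 - weakDeriv 1 u z) 2 discMeasure)
      atTop (𝓝 0) ∧
    Tendsto (fun n =>
      eLpNorm (fun z => fderiv ℝ (φ n) z Complex.I - weakDeriv Complex.I u z) 2 discMeasure)
      atTop (𝓝 0) ∧
    Tendsto (fun n => eLpNorm (fun β => φ n (circlePoint β) - g β) 2 AddCircle.haarAddCircle)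
      atTop (𝓝 0)

open Classical in
/-- The trace `u|_Γ` (every `u ∈ H¹(Ω)` has exactly one). -/
def trace (u : L2) : L2Circle :=
  if h : ∃ g, IsTrace u g then h.choose else 0

/-- The terms of the series `‖g‖²_{H^{1/2}(Γ)} = ∑ₖ (1 + k²)^{1/2} |gₖ|²`, where the `gₖ` are the
Fourier coefficients of `g`. -/
def hHalfTerm (g : L2Circle) (k : ℤ) : ℝ :=
  (1 + (k : ℝ) ^ 2) ^ (1 / 2 : ℝ) * ‖fourierCoeff (g : AddCircle (2 * Real.pi) → ℂ) k‖ ^ 2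

/-- `g ∈ H^{1/2}(Γ)`. -/
def MemHHalf (g : L2Circle) : Prop := Summable (hHalfTerm g)

/-- The square of the norm of `H^{1/2}(Γ)`. -/
def hHalfNormSq (g : L2Circle) : ℝ := ∑' k : ℤ, hHalfTerm g k

/-! A sequence `⟨u₀, u₋₁, u₋₂, …⟩` is a function on `ℕ` whose value at `j` is `u₋ⱼ`. -/

/-- The angular weight `(1 + j²)^p`. -/
def weight (p : ℝ) (j : ℕ) : ℝ := (1 + (j : ℝ) ^ 2) ^ p

/-- `u ∈ l^{2,p}(ℕ; L²(Ω))`. -/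
def MemSeqL2 (p : ℝ) (u : ℕ → L2) : Prop :=
  Summable fun j => weight p j * ‖u j‖ ^ 2

/-- The norm `‖u‖_{p,0}`; for `p = 0` it is the norm `‖u‖` of `l²(ℕ; L²(Ω))`. -/
def seqNormL2 (p : ℝ) (u : ℕ → L2) : ℝ :=
  √(∑' j, weight p j * ‖u j‖ ^ 2)

/-- `u ∈ l^{2,p}(ℕ; H¹(Ω))`. -/
def MemSeqH1 (p : ℝ) (u : ℕ → L2) : Prop :=
  (∀ j, MemH1 (u j)) ∧ Summable fun j => weight p j * h1NormSq (u j)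

/-- The norm `‖u‖_{p,1}`. -/
def seqNormH1 (p : ℝ) (u : ℕ → L2) : ℝ :=
  √(∑' j, weight p j * h1NormSq (u j))

/-- `g ∈ l^{2,p}(ℕ; H^{1/2}(Γ))`. -/
def MemSeqHHalf (p : ℝ) (g : ℕ → L2Circle) : Prop :=
  (∀ j, MemHHalf (g j)) ∧ Summable fun j => weight p j * hHalfNormSq (g j)

/-- The norm `‖g‖_{p,1/2}`. -/
def seqNormHHalf (p : ℝ) (g : ℕ → L2Circle) : ℝ :=
  √(∑' j, weight p j * hHalfNormSq (g j))

/-- The left translation `L⟨u₀, u₋₁, …⟩ = ⟨u₋₁, u₋₂, …⟩`. -/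
def shift (u : ℕ → L2) : ℕ → L2 := fun j => u (j + 1)

/-- `∂` of a sequence, componentwise. -/
def delSeq (u : ℕ → L2) : ℕ → L2 := fun j => del (u j)

/-- `∂̄` of a sequence, componentwise. -/
def delbarSeq (u : ℕ → L2) : ℕ → L2 := fun j => delbar (u j)

/-- The trace of a sequence, componentwise. -/
def traceSeq (u : ℕ → L2) : ℕ → L2Circle := fun j => trace (u j)

/-- The Hilbert space `l²(ℕ; L²(Ω))`. -/
abbrev SeqL2 : Type := lp (fun _ : ℕ => L2) 2

/-- `μ` is a constant for the Poincaré inequality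
`‖u‖² ≤ μ (‖∂u‖² + ‖u|_Γ‖²_{0,1/2})` on `l²(ℕ; H¹(Ω))`. -/
def IsPoincareConstant (μ : ℝ) : Prop :=
  ∀ u : ℕ → L2, MemSeqH1 0 u →
    seqNormL2 0 u ^ 2 ≤ μ * (seqNormL2 0 (delSeq u) ^ 2 + seqNormHHalf 0 (traceSeq u) ^ 2)

/-- `B` maps `l²(ℕ; L²(Ω))` to `l^{2,1}(ℕ; L²(Ω))` and `l²(ℕ; H¹(Ω))` to `l^{2,1}(ℕ; H¹(Ω))`, both
with bound `C`. -/
def IsSmoothingWithBound (B : SeqL2 →ₗ[ℂ] (ℕ → L2)) (C : ℝ) : Prop :=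
  (∀ u : SeqL2, MemSeqL2 1 (B u) ∧ seqNormL2 1 (B u) ≤ C * seqNormL2 0 u) ∧
  (∀ u : SeqL2, MemSeqH1 0 u → MemSeqH1 1 (B u) ∧ seqNormH1 1 (B u) ≤ C * seqNormH1 0 u)

end BukhgeimBeltrami

end

noncomputable section

namespace BukhgeimBeltrami

/-! The estimate rests on Green's identity on the disc, `‖∂u‖² - ‖∂̄u‖² = π ∑ k |gₖ|²`, where `gₖ`
are the Fourier coefficients of the boundary values of `u`. It is proved for smooth `u`
(`hasSum_green`) by applying the divergence theorem to the Jacobian of `u` and its conjugate. Only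
the bound `|‖∂u‖² - ‖∂̄u‖²| ≤ π ‖g‖²_{1/2}` is kept for `u ∈ H¹` (`IsTrace.abs_green_le`).

Passing to `H¹` needs two facts. Mollification after a dilation approximates every `u ∈ H¹` by
functions smooth on the whole plane (`tendsto_smoothDeriv_smoothing`). The boundary map is bounded
from `H¹(Ω)` to `H^{1/2}(Γ)`: Bessel's inequality for the orthonormal monomials `√(k/π) z^(k-1)`
bounds the positive frequencies by `‖∂u‖²`, and conjugation bounds the negative ones by `‖∂̄u‖²`
(`sum_circleCoeff_le`). The divergence theorem for the field `z|u|²`, combined with Green's bound,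
gives the Poincaré inequality with constant `4π`.

For a solution, `∂̄v₋ⱼ = (Bv + f)₋ⱼ - ∂v₋ⱼ₋₂`. Insert this into Green's bound, multiply by `wⱼ = (1
+ j²)^{1/2}` and sum. Since `wⱼ + 1 ≤ wⱼ₊₂`, the weighted sums telescope and leave the unweighted
`‖∂v‖²` on the left (`tsum_sq_le_of_recursion`). The cross term is controlled by Cauchy–Schwarz, and
`Bv` by its `L²` bound together with Poincaré. The result is `a X² ≤ b X + c` for `X = ‖∂v‖`, so `X`
is at most the larger root. -/

/-! ### Polar coordinates and the divergence theorem on the disc. -/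

lemma integral_disc_polar (G : ℂ → ℂ) :
    ∫ z, G z ∂discMeasure =
      ∫ p in Set.Icc ((0 : ℝ), -Real.pi) (1, Real.pi),
        (p.1 : ℂ) * G (p.1 * Complex.exp (Complex.I * p.2)) := by
  rw [discMeasure, disc, ← integral_indicator Metric.isOpen_ball.measurableSet,
    ← Complex.integral_comp_polarCoord_symm]
  have hT : polarCoord.target = Set.Ioi (0 : ℝ) ×ˢ Set.Ioo (-Real.pi) Real.pi := rfl
  rw [hT, ← Set.Icc_prod_Icc, ← integral_indicator (measurableSet_Ioi.prod measurableSet_Ioo)]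
  -- The closed rectangle is the form required by the divergence theorem on boxes; its boundary is
  -- null.
  have h2 : (Set.Icc (0 : ℝ) 1 ×ˢ Set.Icc (-Real.pi) Real.pi : Set (ℝ × ℝ)) =ᵐ[volume]
      (Set.Ioo (0 : ℝ) 1 ×ˢ Set.Ioo (-Real.pi) Real.pi : Set (ℝ × ℝ)) :=
    Measure.set_prod_ae_eq Ioo_ae_eq_Icc.symm Ioo_ae_eq_Icc.symm
  rw [setIntegral_congr_set h2, ← integral_indicator (measurableSet_Ioo.prod measurableSet_Ioo)]
  congr 1
  ext ⟨r, θ⟩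
  have he : Complex.polarCoord.symm (r, θ) = r * Complex.exp (Complex.I * θ) := by
    rw [Complex.polarCoord_symm_apply, mul_comm Complex.I, Complex.exp_mul_I]
    simp
  by_cases hr : 0 < r
  · by_cases hθ : θ ∈ Set.Ioo (-Real.pi) Real.pi
    · have m1 : (r, θ) ∈ Set.Ioi (0 : ℝ) ×ˢ Set.Ioo (-Real.pi) Real.pi := ⟨hr, hθ⟩
      rw [Set.indicator_of_mem m1]
      by_cases h1 : r < 1
      · have m2 : (r, θ) ∈ Set.Ioo (0 : ℝ) 1 ×ˢ Set.Ioo (-Real.pi) Real.pi := ⟨⟨hr, h1⟩, hθ⟩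
        have m3 : Complex.polarCoord.symm (r, θ) ∈ Metric.ball (0 : ℂ) 1 := by
          rw [mem_ball_zero_iff, Complex.norm_polarCoord_symm, abs_of_pos hr]
          exact h1
        rw [Set.indicator_of_mem m2, Set.indicator_of_mem m3, he, Complex.real_smul]
      · have m2 : (r, θ) ∉ Set.Ioo (0 : ℝ) 1 ×ˢ Set.Ioo (-Real.pi) Real.pi := fun h => h1 h.1.2
        have m3 : Complex.polarCoord.symm (r, θ) ∉ Metric.ball (0 : ℂ) 1 := by
          rw [mem_ball_zero_iff, Complex.norm_polarCoord_symm, abs_of_pos hr]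
          exact h1
        rw [Set.indicator_of_notMem m2, Set.indicator_of_notMem m3, smul_zero]
    · rw [Set.indicator_of_notMem (fun h => hθ h.2), Set.indicator_of_notMem (fun h => hθ h.2)]
  · rw [Set.indicator_of_notMem (fun h => hr h.1), Set.indicator_of_notMem (fun h => hr h.1.1)]

/-- The factor `2π` appears because `haarAddCircle` is normalised to total mass one. -/
lemma integral_circle (h : ℂ → ℂ) :
    ∫ θ in (-Real.pi)..Real.pi, h (Complex.exp (Complex.I * θ)) =
      2 * Real.pi * ∫ β, h (circlePoint β) ∂AddCircle.haarAddCircle := by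
  rw [AddCircle.integral_haarAddCircle, ← AddCircle.intervalIntegral_preimage _ (-Real.pi)]
  have : -Real.pi + 2 * Real.pi = Real.pi := by ring
  rw [this, Complex.real_smul]
  have hpi : (Real.pi : ℂ) ≠ 0 := by exact_mod_cast Real.pi_ne_zero
  push_cast
  rw [← mul_assoc, mul_inv_cancel₀ (by simp [hpi]), one_mul]
  congr 1
  ext θ
  congr 1
  rw [circlePoint, AddCircle.toCircle_apply_mk, Circle.coe_exp]
  congr 1
  have : 2 * Real.pi / (2 * Real.pi) = 1 := div_self (by positivity)
  rw [this, one_mul, mul_comm]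

/-- The divergence theorem on the unit disc, for the field `F e` of constant direction `e`. -/
lemma integral_disc_fderiv (F : ℂ → ℂ) (hF : ContDiff ℝ 1 F) (e : ℂ) :
    ∫ z, fderiv ℝ F z e ∂discMeasure = 2 * Real.pi * ∫ β,
      ((e * (starRingEnd ℂ) (circlePoint β)).re : ℂ) * F (circlePoint β)
        ∂AddCircle.haarAddCircle := by
  rw [← integral_circle (fun c => ((e * (starRingEnd ℂ) c).re : ℂ) * F c), integral_disc_polar]
  set E : ℝ → ℂ := fun θ => Complex.exp (Complex.I * θ) with hE
  have hEs : ContDiff ℝ 1 E := by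
    rw [hE]; exact (contDiff_const.mul Complex.ofRealCLM.contDiff).cexp
  have hE' : ∀ θ, HasDerivAt E (Complex.I * E θ) θ := by
    intro θ
    have h1 : HasDerivAt (fun t : ℝ => Complex.I * (t : ℂ)) (Complex.I * 1) θ :=
      (Complex.ofRealCLM.hasDerivAt (x := θ)).const_mul _
    simpa [hE, mul_comm] using h1.cexp
  set X : ℝ → ℂ := fun θ => e * (starRingEnd ℂ) (E θ) with hX
  have hXs : ContDiff ℝ 1 X := contDiff_const.mul (Complex.conjCLE.contDiff.comp hEs)
  have hX' : ∀ θ, HasDerivAt X (-Complex.I * X θ) θ := by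
    intro θ
    have h := ((Complex.conjCLE.hasFDerivAt.comp_hasDerivAt θ (hE' θ)).const_mul e)
    convert! h using 1
    simp [hX]
    ring
  set P : ℝ × ℝ → ℂ := fun p => p.1 * E p.2 with hP
  have hPs : ContDiff ℝ 1 P :=
    (Complex.ofRealCLM.contDiff.comp contDiff_fst).mul (hEs.comp contDiff_snd)
  -- `Re X` and `Im X` are the radial and angular components of `e`, so `(f, g)` is the flux of `F
  -- e` in polar coordinates; its divergence in `(r, θ)` is `r` times the derivative of `F` along
  -- `e`.
  set f : ℝ × ℝ → ℂ := fun p => p.1 * ((X p.2).re : ℂ) * F (P p) with hf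
  set g : ℝ × ℝ → ℂ := fun p => ((X p.2).im : ℂ) * F (P p) with hg
  have hfs : ContDiff ℝ 1 f :=
    ((Complex.ofRealCLM.contDiff.comp contDiff_fst).mul
      (Complex.ofRealCLM.contDiff.comp (Complex.reCLM.contDiff.comp (hXs.comp contDiff_snd)))).mul
      (hF.comp hPs)
  have hgs : ContDiff ℝ 1 g :=
    (Complex.ofRealCLM.contDiff.comp (Complex.imCLM.contDiff.comp (hXs.comp contDiff_snd))).mul
      (hF.comp hPs)
  have hdf := hfs.differentiable one_ne_zero
  have hdg := hgs.differentiable one_ne_zero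
  have hdF := hF.differentiable one_ne_zero
  have key : ∀ p : ℝ × ℝ, fderiv ℝ f p (1, 0) + fderiv ℝ g p (0, 1) =
      (p.1 : ℂ) * fderiv ℝ F (P p) e := by
    rintro ⟨r, θ⟩
    have h1 : HasDerivAt (fun s : ℝ => f (s, θ)) (fderiv ℝ f (r, θ) (1, 0)) r :=
      HasFDerivAt.comp_hasDerivAt (l := f) (f := fun s => (s, θ)) r (hdf (r, θ)).hasFDerivAt
        ((hasDerivAt_id' r).prodMk (hasDerivAt_const r θ))
    have h2 : HasDerivAt (fun s : ℝ => g (r, s)) (fderiv ℝ g (r, θ) (0, 1)) θ :=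
      HasFDerivAt.comp_hasDerivAt (l := g) (f := fun s => (r, s)) θ (hdg (r, θ)).hasFDerivAt
        ((hasDerivAt_const θ r).prodMk (hasDerivAt_id' θ))
    have hr : HasDerivAt (fun s : ℝ => (s : ℂ)) 1 r := Complex.ofRealCLM.hasDerivAt
    have k1 : HasDerivAt (fun s : ℝ => F (P (s, θ))) (fderiv ℝ F (P (r, θ)) (E θ)) r := by
      have : HasDerivAt (fun s : ℝ => P (s, θ)) (E θ) r := by
        simpa using hr.mul_const (E θ)
      exact (hdF _).hasFDerivAt.comp_hasDerivAt r this
    have k2 : HasDerivAt (fun s : ℝ => F (P (r, s)))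
        (fderiv ℝ F (P (r, θ)) (r * (Complex.I * E θ))) θ :=
      (hdF _).hasFDerivAt.comp_hasDerivAt θ ((hE' θ).const_mul (r : ℂ))
    have h1' : HasDerivAt (fun s : ℝ => f (s, θ)) _ r := (hr.mul_const ((X θ).re : ℂ)).mul k1
    have hXim : HasDerivAt (fun s : ℝ => ((X s).im : ℂ)) (((-Complex.I * X θ).im : ℝ) : ℂ) θ :=
      (Complex.ofRealCLM.hasFDerivAt.comp_hasDerivAt θ
        (Complex.imCLM.hasFDerivAt.comp_hasDerivAt θ (hX' θ)))
    have h2' : HasDerivAt (fun s : ℝ => g (r, s)) _ θ := hXim.mul k2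
    rw [h1.unique h1', h2.unique h2']
    have he : e = (X θ).re • E θ + (X θ).im • (Complex.I * E θ) := by
      have hn : (starRingEnd ℂ) (E θ) * E θ = 1 := by
        rw [hE]
        simp only
        rw [← Complex.exp_conj, ← Complex.exp_add]
        simp
      calc e = X θ * E θ := by rw [hX]; simp only; rw [mul_assoc, hn, mul_one]
        _ = ((X θ).re + (X θ).im * Complex.I) * E θ := by rw [Complex.re_add_im]
        _ = _ := by simp only [Complex.real_smul]; ring
    have hsm : (r : ℂ) * (Complex.I * E θ) = r • (Complex.I * E θ) := by simp
    conv_rhs => rw [he]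
    rw [hsm, map_add, map_smul, map_smul, map_smul]
    simp only [Complex.real_smul, neg_mul, Complex.neg_im, Complex.mul_im, Complex.I_re,
      Complex.I_im, zero_mul, one_mul, zero_add]
    push_cast
    ring
  have hdiv := integral_divergence_prod_Icc_of_hasFDerivAt_of_le f g (fderiv ℝ f) (fderiv ℝ g)
    ((0 : ℝ), -Real.pi) (1, Real.pi) ⟨by norm_num, by simp only; linarith [Real.pi_pos]⟩
    hfs.continuous.continuousOn hgs.continuous.continuousOn
    (fun x _ => (hdf x).hasFDerivAt) (fun x _ => (hdg x).hasFDerivAt)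
    (Continuous.integrableOn_Icc
      (((hfs.continuous_fderiv one_ne_zero).clm_apply continuous_const).add
        ((hgs.continuous_fderiv one_ne_zero).clm_apply continuous_const)))
  simp_rw [key] at hdiv
  rw [hdiv]
  -- Of the four sides of the rectangle only `r = 1` contributes: `f` vanishes at `r = 0`, and the
  -- sides `θ = ±π` cancel by periodicity.
  have hper : E Real.pi = E (-Real.pi) := by
    rw [hE]
    simp only [Complex.ofReal_neg, mul_neg, Complex.exp_neg]
    rw [mul_comm Complex.I, Complex.exp_pi_mul_I]
    norm_num
  have hgper : ∀ r, g (r, Real.pi) = g (r, -Real.pi) := by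
    intro r
    simp only [hg, hX, hP, hper]
  simp only [hgper, hf, hP, hX]
  simp [hE]

instance : IsFiniteMeasure discMeasure := by
  refine ⟨?_⟩
  rw [discMeasure, Measure.restrict_apply_univ]
  exact measure_ball_lt_top

lemma memLp_disc {φ : ℂ → ℂ} (hφ : Continuous φ) (p : ℝ≥0∞) : MemLp φ p discMeasure := by
  obtain ⟨C, hC⟩ := (isCompact_closedBall (0 : ℂ) 1).exists_bound_of_continuousOn hφ.continuousOn
  refine MemLp.of_bound hφ.aestronglyMeasurable C ?_
  rw [discMeasure, disc, ae_restrict_iff' Metric.isOpen_ball.measurableSet]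
  exact ae_of_all _ fun z hz => hC z (Metric.ball_subset_closedBall hz)

lemma integrable_disc {φ : ℂ → ℂ} (hφ : Continuous φ) : Integrable φ discMeasure :=
  memLp_one_iff_integrable.1 (memLp_disc hφ 1)

lemma integrable_disc_real {φ : ℂ → ℝ} (hφ : Continuous φ) : Integrable φ discMeasure := by
  simpa using (integrable_disc (Complex.continuous_ofReal.comp hφ)).re

lemma continuous_circlePoint : Continuous circlePoint := by
  unfold circlePoint
  exact continuous_subtype_val.comp AddCircle.continuous_toCircle

lemma norm_circlePoint (β : AddCircle (2 * Real.pi)) : ‖circlePoint β‖ = 1 := by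
  exact Circle.norm_coe _

lemma memLp_circle {f : AddCircle (2 * Real.pi) → ℂ} (hf : Continuous f) (p : ℝ≥0∞) :
    MemLp f p AddCircle.haarAddCircle := by
  obtain ⟨C, hC⟩ := isCompact_univ.exists_bound_of_continuousOn hf.continuousOn
  exact MemLp.of_bound hf.aestronglyMeasurable C (ae_of_all _ fun z => hC z (Set.mem_univ z))

lemma integrable_circle {f : AddCircle (2 * Real.pi) → ℂ} (hf : Continuous f) :
    Integrable f AddCircle.haarAddCircle :=
  memLp_one_iff_integrable.1 (memLp_circle hf 1)

lemma continuous_fderiv_const {φ : ℂ → ℂ} (hφ : ContDiff ℝ ∞ φ) (e : ℂ) :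
    Continuous fun z => fderiv ℝ φ z e :=
  (hφ.continuous_fderiv (by simp)).clm_apply continuous_const

lemma contDiff_fderiv_const {φ : ℂ → ℂ} (hφ : ContDiff ℝ ∞ φ) (e : ℂ) :
    ContDiff ℝ ∞ fun z => fderiv ℝ φ z e :=
  (hφ.fderiv_right (m := ∞) (by simp)).clm_apply contDiff_const

lemma fderiv_fderiv_comm {φ : ℂ → ℂ} (hφ : ContDiff ℝ ∞ φ) (z e e' : ℂ) :
    fderiv ℝ (fun z => fderiv ℝ φ z e) z e' = fderiv ℝ (fun z => fderiv ℝ φ z e') z e := by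
  have hd : DifferentiableAt ℝ (fderiv ℝ φ) z :=
    (hφ.fderiv_right (m := ∞) (by simp)).differentiable (by simp) z
  have h : ∀ a b : ℂ, fderiv ℝ (fun z => fderiv ℝ φ z a) z b = fderiv ℝ (fderiv ℝ φ) z b a := by
    intro a b
    rw [fderiv_clm_apply hd (differentiableAt_const _)]
    simp
  rw [h, h]
  exact (hφ.contDiffAt.isSymmSndFDerivAt
    (by simpa using WithTop.coe_le_coe.2 (le_top : (2 : ℕ∞) ≤ ⊤))) e' e

/-! ### The Jacobian identity and Fourier coefficients on the circle. -/

/-- The angular derivative. -/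
def angDeriv (φ : ℂ → ℂ) (z : ℂ) : ℂ := fderiv ℝ φ z (Complex.I * z)

lemma angDeriv_eq (φ : ℂ → ℂ) (z : ℂ) :
    angDeriv φ z = z.re * fderiv ℝ φ z Complex.I - z.im * fderiv ℝ φ z 1 := by
  have : Complex.I * z = z.re • Complex.I - z.im • (1 : ℂ) := by
    apply Complex.ext <;> simp
  rw [angDeriv, this, map_sub, map_smul, map_smul, Complex.real_smul, Complex.real_smul]

lemma continuous_angDeriv {φ : ℂ → ℂ} (hφ : ContDiff ℝ ∞ φ) : Continuous (angDeriv φ) :=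
  (hφ.continuous_fderiv (by simp)).clm_apply (continuous_const.mul continuous_id)

/-- The Jacobian of a pair of smooth functions integrates to a boundary term. -/
lemma integral_jacobian {φ ψ : ℂ → ℂ} (hφ : ContDiff ℝ ∞ φ) (hψ : ContDiff ℝ ∞ ψ) :
    ∫ z, (fderiv ℝ φ z 1 * fderiv ℝ ψ z Complex.I - fderiv ℝ φ z Complex.I * fderiv ℝ ψ z 1)
      ∂discMeasure =
    2 * Real.pi * ∫ β, φ (circlePoint β) * angDeriv ψ (circlePoint β) ∂AddCircle.haarAddCircle := by
  have hd : ∀ e e' z, fderiv ℝ (fun z => φ z * fderiv ℝ ψ z e) z e' =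
      φ z * fderiv ℝ (fun z => fderiv ℝ ψ z e) z e' + fderiv ℝ ψ z e * fderiv ℝ φ z e' := by
    intro e e' z
    rw [fderiv_fun_mul (hφ.differentiable (by simp) z)
      ((contDiff_fderiv_const hψ e).differentiable (by simp) z)]
    simp
  have h1 := integral_disc_fderiv (fun z => φ z * fderiv ℝ ψ z Complex.I)
    ((hφ.mul (contDiff_fderiv_const hψ _)).of_le (by simp)) 1
  have h2 := integral_disc_fderiv (fun z => φ z * fderiv ℝ ψ z 1)
    ((hφ.mul (contDiff_fderiv_const hψ _)).of_le (by simp)) Complex.I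
  have hc : ∀ e e', Continuous (fun z => fderiv ℝ (fun z => φ z * fderiv ℝ ψ z e) z e') :=
    fun e e' => continuous_fderiv_const (hφ.mul (contDiff_fderiv_const hψ _)) e'
  -- The Jacobian is the divergence of `(φ ψ_y, -φ ψ_x)`, because mixed second derivatives agree.
  have h3 : ∀ z, fderiv ℝ φ z 1 * fderiv ℝ ψ z Complex.I - fderiv ℝ φ z Complex.I * fderiv ℝ ψ z 1
      = fderiv ℝ (fun z => φ z * fderiv ℝ ψ z Complex.I) z 1 -
        fderiv ℝ (fun z => φ z * fderiv ℝ ψ z 1) z Complex.I := by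
    intro z
    rw [hd, hd, fderiv_fderiv_comm hψ z 1]
    ring
  simp_rw [h3]
  rw [integral_sub (integrable_disc (hc _ _)) (integrable_disc (hc _ _)), h1, h2, ← mul_sub,
    ← integral_sub]
  · congr 2
    ext β
    rw [angDeriv_eq]
    simp
    ring
  · refine integrable_circle ?_
    refine (Complex.continuous_ofReal.comp (Complex.continuous_re.comp (continuous_const.mul
      (Complex.continuous_conj.comp continuous_circlePoint)))).mul ?_
    exact (hφ.continuous.mul (continuous_fderiv_const hψ _)).comp continuous_circlePoint
  · refine integrable_circle ?_
    refine (Complex.continuous_ofReal.comp (Complex.continuous_re.comp (continuous_const.mul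
      (Complex.continuous_conj.comp continuous_circlePoint)))).mul ?_
    exact (hφ.continuous.mul (continuous_fderiv_const hψ _)).comp continuous_circlePoint

/-- Integration by parts on the circle, read off from the antisymmetry of the Jacobian in `φ` and
`ψ`. -/
lemma integral_mul_angDeriv {φ ψ : ℂ → ℂ} (hφ : ContDiff ℝ ∞ φ) (hψ : ContDiff ℝ ∞ ψ) :
    ∫ β, φ (circlePoint β) * angDeriv ψ (circlePoint β) ∂AddCircle.haarAddCircle =
      - ∫ β, ψ (circlePoint β) * angDeriv φ (circlePoint β) ∂AddCircle.haarAddCircle := by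
  have h1 := integral_jacobian hφ hψ
  have h2 := integral_jacobian hψ hφ
  have h3 : ∫ z, (fderiv ℝ ψ z 1 * fderiv ℝ φ z Complex.I - fderiv ℝ ψ z Complex.I * fderiv ℝ φ z 1)
      ∂discMeasure = - ∫ z, (fderiv ℝ φ z 1 * fderiv ℝ ψ z Complex.I
        - fderiv ℝ φ z Complex.I * fderiv ℝ ψ z 1) ∂discMeasure := by
    rw [← integral_neg]
    congr 1
    ext z
    ring
  rw [h3, h1] at h2
  have hpi : (2 * Real.pi : ℂ) ≠ 0 := by simp [Real.pi_ne_zero]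
  apply mul_left_cancel₀ hpi
  rw [mul_neg, ← h2, neg_neg]

/-- The monomials `z ^ k` (for `k ≥ 0`) and `conj z ^ (-k)` (for `k < 0`). -/
def monom (k : ℤ) (z : ℂ) : ℂ := z ^ k.toNat * (starRingEnd ℂ) z ^ (-k).toNat

lemma contDiff_monom (k : ℤ) : ContDiff ℝ ∞ (monom k) :=
  (contDiff_id.pow _).mul (Complex.conjCLE.contDiff.pow _)

lemma monom_circlePoint (k : ℤ) (β : AddCircle (2 * Real.pi)) :
    monom k (circlePoint β) = fourier k β := by
  have hc : (starRingEnd ℂ) (circlePoint β) = (circlePoint β)⁻¹ := by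
    rw [Complex.inv_def, Complex.normSq_eq_norm_sq, norm_circlePoint]
    simp
  have h0 : circlePoint β ≠ 0 := by
    rw [← norm_ne_zero_iff, norm_circlePoint]; exact one_ne_zero
  rw [monom, hc, fourier_apply, AddCircle.toCircle_zsmul, Circle.coe_zpow]
  change _ = circlePoint β ^ k
  rw [inv_pow, ← div_eq_mul_inv, ← zpow_natCast, ← zpow_natCast, ← zpow_sub₀ h0]
  congr 1
  omega

lemma hasFDerivAt_pow_real (n : ℕ) (z : ℂ) :
    HasFDerivAt (fun z : ℂ => z ^ n)
      ((n * z ^ (n - 1) : ℂ) • (ContinuousLinearMap.id ℝ ℂ)) z := by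
  have := (hasDerivAt_pow n z).hasFDerivAt.restrictScalars ℝ
  convert! this using 1
  ext
  simp [mul_comm]

lemma hasFDerivAt_conj_pow (n : ℕ) (z : ℂ) :
    HasFDerivAt (fun z : ℂ => (starRingEnd ℂ) z ^ n)
      ((n * (starRingEnd ℂ) z ^ (n - 1) : ℂ) • (Complex.conjCLE : ℂ →L[ℝ] ℂ)) z := by
  have := (hasFDerivAt_pow_real n ((starRingEnd ℂ) z)).comp z Complex.conjCLE.hasFDerivAt
  convert! this using 1

lemma angDeriv_monom (k : ℤ) (z : ℂ) : angDeriv (monom k) z = Complex.I * k * monom k z := by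
  rw [angDeriv]
  have h := ((hasFDerivAt_pow_real k.toNat z).mul (hasFDerivAt_conj_pow (-k).toNat z)).fderiv
  change fderiv ℝ (monom k) z = _ at h
  rw [h]
  obtain ⟨n, rfl | rfl⟩ := k.eq_nat_or_neg
  · have t : (-(n : ℤ)).toNat = 0 := by omega
    rcases n with _ | n
    · simp
    · simp only [monom, t, Int.toNat_natCast]
      simp [pow_succ]
      ring
  · have t : (-(n : ℤ)).toNat = 0 := by omega
    rcases n with _ | n
    · simp
    · simp only [monom, t, neg_neg, Int.toNat_natCast]
      simp [pow_succ]
      ring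

/-- Fourier coefficients of the restriction to the unit circle. -/
def circleCoeff (φ : ℂ → ℂ) (k : ℤ) : ℂ := fourierCoeff (fun β => φ (circlePoint β)) k

/-- The Fourier mode is replaced by a smooth function on the plane, so that the disc identities
apply to it. -/
lemma circleCoeff_eq (φ : ℂ → ℂ) (k : ℤ) :
    circleCoeff φ k = ∫ β, monom (-k) (circlePoint β) * φ (circlePoint β)
      ∂AddCircle.haarAddCircle := by
  simp only [circleCoeff, fourierCoeff, monom_circlePoint, smul_eq_mul]

lemma circleCoeff_angDeriv {φ : ℂ → ℂ} (hφ : ContDiff ℝ ∞ φ) (k : ℤ) :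
    circleCoeff (angDeriv φ) k = Complex.I * k * circleCoeff φ k := by
  rw [circleCoeff_eq, circleCoeff_eq, integral_mul_angDeriv (contDiff_monom _) hφ,
    ← integral_const_mul, ← integral_neg]
  congr 1
  ext β
  rw [angDeriv_monom]
  push_cast
  ring

lemma circleCoeff_monom (m k : ℤ) : circleCoeff (monom m) k = if m = k then 1 else 0 := by
  simp only [circleCoeff, monom_circlePoint]
  have := fourierCoeff_fourier (T := 2 * Real.pi) m
  rw [show (fun β : AddCircle (2 * Real.pi) => fourier m β) = fourier m from rfl, this]
  simp [Pi.single_apply, eq_comm]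

/-! ### Continuous functions as elements of the `L²` spaces. -/

/-- The element of `L²(Ω)` given by a continuous function. -/
def ofCont (φ : ℂ → ℂ) (hφ : Continuous φ) : L2 := (memLp_disc hφ 2).toLp φ

lemma coeFn_ofCont {φ : ℂ → ℂ} (hφ : Continuous φ) : ofCont φ hφ =ᵐ[discMeasure] φ :=
  MemLp.coeFn_toLp _

lemma inner_ofCont {φ ψ : ℂ → ℂ} (hφ : Continuous φ) (hψ : Continuous ψ) :
    inner ℂ (ofCont φ hφ) (ofCont ψ hψ) = ∫ z, (starRingEnd ℂ) (φ z) * ψ z ∂discMeasure := by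
  rw [L2.inner_def]
  refine integral_congr_ae ?_
  filter_upwards [coeFn_ofCont hφ, coeFn_ofCont hψ] with z h1 h2
  rw [h1, h2, RCLike.inner_apply, mul_comm]

lemma norm_sq_ofCont {φ : ℂ → ℂ} (hφ : Continuous φ) :
    ‖ofCont φ hφ‖ ^ 2 = ∫ z, ‖φ z‖ ^ 2 ∂discMeasure := by
  have h := inner_self_eq_norm_sq_to_K (𝕜 := ℂ) (ofCont φ hφ)
  rw [inner_ofCont] at h
  have h2 : ∀ z, (starRingEnd ℂ) (φ z) * φ z = ((‖φ z‖ ^ 2 : ℝ) : ℂ) := by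
    intro z
    rw [Complex.conj_mul']
    push_cast
    rfl
  simp_rw [h2] at h
  rw [integral_complex_ofReal] at h
  exact Complex.ofReal_injective ((Complex.ofReal_pow _ _).trans h.symm)

/-- The element of `L²(Γ)` given by a continuous function. -/
def circleOfCont (f : AddCircle (2 * Real.pi) → ℂ) (hf : Continuous f) : L2Circle :=
  (memLp_circle hf 2).toLp f

lemma coeFn_circleOfCont {f : AddCircle (2 * Real.pi) → ℂ} (hf : Continuous f) :
    circleOfCont f hf =ᵐ[AddCircle.haarAddCircle] f :=
  MemLp.coeFn_toLp _

lemma fourierCoeff_circleOfCont {f : AddCircle (2 * Real.pi) → ℂ} (hf : Continuous f) (k : ℤ) :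
    fourierCoeff (circleOfCont f hf) k = fourierCoeff f k := by
  rw [fourierCoeff_congr_ae (coeFn_circleOfCont hf)]

lemma inner_circleOfCont {f g : AddCircle (2 * Real.pi) → ℂ} (hf : Continuous f)
    (hg : Continuous g) :
    inner ℂ (circleOfCont f hf) (circleOfCont g hg) =
      ∫ β, (starRingEnd ℂ) (f β) * g β ∂AddCircle.haarAddCircle := by
  rw [L2.inner_def]
  refine integral_congr_ae ?_
  filter_upwards [coeFn_circleOfCont hf, coeFn_circleOfCont hg] with z h1 h2
  rw [h1, h2, RCLike.inner_apply, mul_comm]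

lemma norm_sq_circleOfCont {f : AddCircle (2 * Real.pi) → ℂ} (hf : Continuous f) :
    ‖circleOfCont f hf‖ ^ 2 = ∫ β, ‖f β‖ ^ 2 ∂AddCircle.haarAddCircle := by
  have h := inner_self_eq_norm_sq_to_K (𝕜 := ℂ) (circleOfCont f hf)
  rw [inner_circleOfCont] at h
  have h2 : ∀ z, (starRingEnd ℂ) (f z) * f z = ((‖f z‖ ^ 2 : ℝ) : ℂ) := by
    intro z
    rw [Complex.conj_mul']
    push_cast
    rfl
  simp_rw [h2] at h
  rw [integral_complex_ofReal] at h
  exact Complex.ofReal_injective ((Complex.ofReal_pow _ _).trans h.symm)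

lemma hasSum_conj_fourierCoeff_mul (x y : L2Circle) :
    HasSum (fun k => (starRingEnd ℂ) (fourierCoeff x k) * fourierCoeff y k) (inner ℂ x y) := by
  have h := (fourierBasis (T := 2 * Real.pi)).hasSum_inner_mul_inner x y
  convert! h using 2 with k
  rw [← fourierBasis_repr, ← fourierBasis_repr, HilbertBasis.repr_apply_apply,
    HilbertBasis.repr_apply_apply, inner_conj_symm]

/-! ### The operators `∂` and `∂̄`: Bessel's inequality and Green's identity. -/

/-- The classical derivative `∂ = (∂ₓ - i ∂_y) / 2`. -/
def dz (φ : ℂ → ℂ) (z : ℂ) : ℂ :=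
  (1 / 2 : ℂ) * (fderiv ℝ φ z 1 - Complex.I * fderiv ℝ φ z Complex.I)

/-- The classical derivative `∂̄ = (∂ₓ + i ∂_y) / 2`. -/
def dzbar (φ : ℂ → ℂ) (z : ℂ) : ℂ :=
  (1 / 2 : ℂ) * (fderiv ℝ φ z 1 + Complex.I * fderiv ℝ φ z Complex.I)

lemma continuous_dz {φ : ℂ → ℂ} (hφ : ContDiff ℝ ∞ φ) : Continuous (dz φ) :=
  continuous_const.mul ((continuous_fderiv_const hφ _).sub
    (continuous_const.mul (continuous_fderiv_const hφ _)))

lemma continuous_dzbar {φ : ℂ → ℂ} (hφ : ContDiff ℝ ∞ φ) : Continuous (dzbar φ) :=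
  continuous_const.mul ((continuous_fderiv_const hφ _).add
    (continuous_const.mul (continuous_fderiv_const hφ _)))

lemma contDiff_conj {φ : ℂ → ℂ} (hφ : ContDiff ℝ ∞ φ) :
    ContDiff ℝ ∞ fun z => (starRingEnd ℂ) (φ z) :=
  Complex.conjCLE.contDiff.comp hφ

lemma fderiv_conj {φ : ℂ → ℂ} (hφ : ContDiff ℝ ∞ φ) (z e : ℂ) :
    fderiv ℝ (fun z => (starRingEnd ℂ) (φ z)) z e = (starRingEnd ℂ) (fderiv ℝ φ z e) := by
  have h : HasFDerivAt (fun z => (starRingEnd ℂ) (φ z)) _ z :=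
    Complex.conjCLE.hasFDerivAt.comp z (hφ.differentiable (by simp) z).hasFDerivAt
  rw [h.fderiv]
  simp

lemma dz_conj {φ : ℂ → ℂ} (hφ : ContDiff ℝ ∞ φ) (z : ℂ) :
    dz (fun z => (starRingEnd ℂ) (φ z)) z = (starRingEnd ℂ) (dzbar φ z) := by
  simp only [dz, dzbar, fderiv_conj hφ, map_mul, map_add, Complex.conj_I, map_div₀, map_one,
    map_ofNat]
  ring

lemma circleCoeff_conj (φ : ℂ → ℂ) (k : ℤ) :
    circleCoeff (fun z => (starRingEnd ℂ) (φ z)) k = (starRingEnd ℂ) (circleCoeff φ (-k)) := by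
  rw [circleCoeff_eq, circleCoeff_eq, ← integral_conj]
  congr 1
  ext β
  rw [map_mul, monom_circlePoint, monom_circlePoint, neg_neg, fourier_neg]

/-- The Jacobian of `φ` with the antiholomorphic `conj z ^ k` involves only `∂φ`, while the boundary
term is a multiple of the `k`-th Fourier coefficient. The truncated exponent `k.toNat - 1` is
harmless as `k > 0`. -/
lemma integral_conj_pow_mul_dz {φ : ℂ → ℂ} (hφ : ContDiff ℝ ∞ φ) {k : ℤ} (hk : 0 < k) :
    ∫ z, (starRingEnd ℂ) (z ^ (k.toNat - 1)) * dz φ z ∂discMeasure =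
      Real.pi * circleCoeff φ k := by
  have hj := integral_jacobian hφ (contDiff_monom (-k))
  have hm : monom (-k) = fun z => (starRingEnd ℂ) z ^ k.toNat := by
    ext z
    simp [monom, Int.toNat_of_nonpos (by omega : -k ≤ 0)]
  have hd : ∀ z e, fderiv ℝ (monom (-k)) z e =
      k * (starRingEnd ℂ) (z ^ (k.toNat - 1)) * (starRingEnd ℂ) e := by
    intro z e
    rw [hm, (hasFDerivAt_conj_pow k.toNat z).fderiv]
    have : ((k.toNat : ℕ) : ℂ) = (k : ℂ) := by
      exact_mod_cast congrArg (Int.cast (R := ℂ)) (Int.toNat_of_nonneg hk.le)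
    simp [this]
  have h1 : ∀ z, fderiv ℝ φ z 1 * fderiv ℝ (monom (-k)) z Complex.I
      - fderiv ℝ φ z Complex.I * fderiv ℝ (monom (-k)) z 1 =
      (-2 * Complex.I * k) * ((starRingEnd ℂ) (z ^ (k.toNat - 1)) * dz φ z) := by
    intro z
    rw [hd, hd, dz]
    simp only [Complex.conj_I, map_one]
    linear_combination (-(fderiv ℝ φ z Complex.I) * k * (starRingEnd ℂ) (z ^ (k.toNat - 1))) *
      Complex.I_sq
  have h2 : ∀ β, φ (circlePoint β) * angDeriv (monom (-k)) (circlePoint β) =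
      (-Complex.I * k) * (monom (-k) (circlePoint β) * φ (circlePoint β)) := by
    intro β
    rw [angDeriv_monom]
    push_cast
    ring
  simp_rw [h1, h2] at hj
  rw [integral_const_mul, integral_const_mul, ← circleCoeff_eq] at hj
  have hne : (-2 * Complex.I * k : ℂ) ≠ 0 := by
    simp [hk.ne']
  apply mul_left_cancel₀ hne
  rw [hj]
  ring

lemma dz_monom {m : ℤ} (hm : 0 < m) (z : ℂ) : dz (monom m) z = m * z ^ (m.toNat - 1) := by
  have hm' : monom m = fun z => z ^ m.toNat := by
    ext z
    simp [monom, Int.toNat_of_nonpos (by omega : -m ≤ 0)]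
  have : ((m.toNat : ℕ) : ℂ) = (m : ℂ) := by
    exact_mod_cast congrArg (Int.cast (R := ℂ)) (Int.toNat_of_nonneg hm.le)
  rw [dz, hm', (hasFDerivAt_pow_real m.toNat z).fderiv]
  simp [this]
  linear_combination (-(1/2 : ℂ) * m * z ^ (m.toNat - 1)) * Complex.I_sq

/-- The preceding identity for `φ = z ^ m`, whose only nonzero Fourier coefficient is the `m`-th. -/
lemma integral_conj_pow_mul_pow {k m : ℤ} (hk : 0 < k) (hm : 0 < m) :
    ∫ z : ℂ, (starRingEnd ℂ) (z ^ (k.toNat - 1)) * z ^ (m.toNat - 1) ∂discMeasure =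
      if m = k then (Real.pi / m : ℂ) else 0 := by
  have h := integral_conj_pow_mul_dz (contDiff_monom m) hk
  simp_rw [dz_monom hm, circleCoeff_monom] at h
  have h1 : ∀ z : ℂ, (starRingEnd ℂ) (z ^ (k.toNat - 1)) * (m * z ^ (m.toNat - 1)) =
    m * ((starRingEnd ℂ) (z ^ (k.toNat - 1)) * z ^ (m.toNat - 1)) := fun z => by ring
  simp_rw [h1] at h
  rw [integral_const_mul] at h
  have hne : (m : ℂ) ≠ 0 := by exact_mod_cast hm.ne'
  apply mul_left_cancel₀ hne
  rw [h]
  split_ifs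
  · field_simp
  · simp

lemma continuous_bergman (k : ℤ) :
    Continuous fun z : ℂ => ((√(k / Real.pi) : ℝ) : ℂ) * z ^ (k.toNat - 1) := by
  fun_prop

/-- The monomials, normalised in `L²(Ω)`. -/
def bergman (k : {k : ℤ // 0 < k}) : L2 := ofCont _ (continuous_bergman k)

lemma orthonormal_bergman : Orthonormal ℂ bergman := by
  rw [orthonormal_iff_ite]
  rintro ⟨k, hk⟩ ⟨m, hm⟩
  rw [bergman, bergman, inner_ofCont]
  have h1 : ∀ z : ℂ, (starRingEnd ℂ) (((√(k / Real.pi) : ℝ) : ℂ) * z ^ (k.toNat - 1)) *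
      (((√(m / Real.pi) : ℝ) : ℂ) * z ^ (m.toNat - 1)) =
      (√(k / Real.pi) : ℝ) * (√(m / Real.pi) : ℝ) *
        ((starRingEnd ℂ) (z ^ (k.toNat - 1)) * z ^ (m.toNat - 1)) := by
    intro z
    rw [map_mul, Complex.conj_ofReal]
    ring
  simp only [h1]
  rw [integral_const_mul, integral_conj_pow_mul_pow hk hm]
  by_cases h : m = k
  · subst h
    have hm' : (0 : ℝ) < m := by exact_mod_cast hm
    have : √(m / Real.pi) * √(m / Real.pi) = (m : ℝ) / Real.pi :=
      Real.mul_self_sqrt (by positivity)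
    rw [← Complex.ofReal_mul, this]
    have hne : (m : ℂ) ≠ 0 := by exact_mod_cast hm.ne'
    have hpi : (Real.pi : ℂ) ≠ 0 := by exact_mod_cast Real.pi_ne_zero
    simp
    field_simp
  · rw [if_neg h, if_neg (by simpa [eq_comm] using h), mul_zero]

/-- Bessel's inequality for `∂φ`: its inner product with the `k`-th normalised monomial is `√(k/π) ·
π` times the `k`-th coefficient. -/
lemma sum_pos_circleCoeff_le {φ : ℂ → ℂ} (hφ : ContDiff ℝ ∞ φ) (S : Finset ℤ) :
    ∑ k ∈ S with 0 < k, Real.pi * |(k : ℝ)| * ‖circleCoeff φ k‖ ^ 2 ≤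
      ∫ z, ‖dz φ z‖ ^ 2 ∂discMeasure := by
  have h := orthonormal_bergman.sum_inner_products_le (s := S.subtype (0 < ·))
    (ofCont (dz φ) (continuous_dz hφ))
  rw [norm_sq_ofCont] at h
  refine le_trans (le_of_eq ?_) h
  rw [← Finset.sum_subtype_eq_sum_filter]
  refine Finset.sum_congr rfl ?_
  rintro ⟨k, hk⟩ _
  rw [bergman, inner_ofCont]
  have h1 : ∀ z : ℂ, (starRingEnd ℂ) (((√(k / Real.pi) : ℝ) : ℂ) * z ^ (k.toNat - 1)) * dz φ z =
      (√(k / Real.pi) : ℝ) * ((starRingEnd ℂ) (z ^ (k.toNat - 1)) * dz φ z) := by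
    intro z
    rw [map_mul, Complex.conj_ofReal]
    ring
  simp only [h1]
  rw [integral_const_mul, integral_conj_pow_mul_dz hφ hk, norm_mul, norm_mul, mul_pow, mul_pow,
    Complex.norm_real, Complex.norm_real, Real.norm_of_nonneg (Real.sqrt_nonneg _),
    Real.norm_of_nonneg Real.pi_pos.le]
  have hk' : (0 : ℝ) < k := by exact_mod_cast hk
  rw [Real.sq_sqrt (by positivity), abs_of_pos hk']
  have := Real.pi_ne_zero
  field_simp

/-- Conjugating `φ` turns `∂̄` into `∂` and reflects the frequencies, which supplies the negative
half. -/
lemma sum_circleCoeff_le {φ : ℂ → ℂ} (hφ : ContDiff ℝ ∞ φ) (S : Finset ℤ) :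
    ∑ k ∈ S, Real.pi * |(k : ℝ)| * ‖circleCoeff φ k‖ ^ 2 ≤
      ∫ z, ‖dz φ z‖ ^ 2 ∂discMeasure + ∫ z, ‖dzbar φ z‖ ^ 2 ∂discMeasure := by
  have h1 := sum_pos_circleCoeff_le hφ S
  have h2 := sum_pos_circleCoeff_le (contDiff_conj hφ) (S.map (Equiv.neg ℤ).toEmbedding)
  simp only [dz_conj hφ, circleCoeff_conj, RCLike.norm_conj] at h2
  rw [Finset.sum_filter, Finset.sum_map] at h2
  rw [Finset.sum_filter] at h1
  refine le_trans ?_ (add_le_add h1 h2)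
  rw [← Finset.sum_add_distrib]
  refine Finset.sum_le_sum fun k _ => ?_
  rcases lt_trichotomy k 0 with h | h | h
  · simp [h, not_lt.2 h.le]
  · simp [h]
  · simp [h, not_lt.2 h.le]

lemma continuous_comp_circlePoint {φ : ℂ → ℂ} (hφ : Continuous φ) :
    Continuous fun β => φ (circlePoint β) :=
  hφ.comp continuous_circlePoint

lemma integrable_norm_sq {φ : ℂ → ℂ} (hφ : Continuous φ) :
    Integrable (fun z => ‖φ z‖ ^ 2) discMeasure :=
  integrable_disc_real (hφ.norm.pow 2)

/-- The right side is `i/2` times the Jacobian of `φ` and its conjugate, hence integrates to a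
boundary term. -/
lemma norm_sq_dz_sub (φ : ℂ → ℂ) (z : ℂ) :
    ((‖dz φ z‖ ^ 2 - ‖dzbar φ z‖ ^ 2 : ℝ) : ℂ) = Complex.I / 2 *
      (fderiv ℝ φ z 1 * (starRingEnd ℂ) (fderiv ℝ φ z Complex.I) -
        fderiv ℝ φ z Complex.I * (starRingEnd ℂ) (fderiv ℝ φ z 1)) := by
  push_cast
  rw [← Complex.conj_mul', ← Complex.conj_mul', dz, dzbar]
  simp only [map_mul, map_add, map_sub, Complex.conj_I, map_div₀, map_one, map_ofNat]
  ring

/-- Green's identity for `∂` and `∂̄`, in terms of the Fourier coefficients on the circle. -/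
lemma hasSum_green {φ : ℂ → ℂ} (hφ : ContDiff ℝ ∞ φ) :
    HasSum (fun k : ℤ => Real.pi * (k * ‖circleCoeff φ k‖ ^ 2))
      (∫ z, ‖dz φ z‖ ^ 2 ∂discMeasure - ∫ z, ‖dzbar φ z‖ ^ 2 ∂discMeasure) := by
  have hj := integral_jacobian hφ (contDiff_conj hφ)
  simp only [fderiv_conj hφ, angDeriv] at hj
  have h1 : ((∫ z, ‖dz φ z‖ ^ 2 ∂discMeasure - ∫ z, ‖dzbar φ z‖ ^ 2 ∂discMeasure : ℝ) : ℂ) =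
      Complex.I / 2 * (2 * Real.pi * ∫ β, φ (circlePoint β) *
        (starRingEnd ℂ) (angDeriv φ (circlePoint β)) ∂AddCircle.haarAddCircle) := by
    rw [← integral_sub (integrable_norm_sq (continuous_dz hφ))
      (integrable_norm_sq (continuous_dzbar hφ)), ← integral_complex_ofReal]
    simp_rw [norm_sq_dz_sub]
    rw [integral_const_mul, hj]
    rfl
  -- Parseval on the circle; the angular derivative multiplies the `k`-th coefficient by `ik`.
  have h2 := hasSum_conj_fourierCoeff_mul
    (circleOfCont _ (continuous_comp_circlePoint (continuous_angDeriv hφ)))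
    (circleOfCont _ (continuous_comp_circlePoint hφ.continuous))
  rw [inner_circleOfCont] at h2
  simp only [fourierCoeff_circleOfCont] at h2
  rw [← Complex.hasSum_ofReal, h1]
  have h3 := (h2.mul_left (Complex.I / 2 * (2 * Real.pi)))
  rw [mul_assoc] at h3
  simp_rw [mul_comm (φ _)]
  convert! h3 using 2 with k
  have e1 : fourierCoeff (fun β => angDeriv φ (circlePoint β)) k =
      Complex.I * k * circleCoeff φ k := circleCoeff_angDeriv hφ k
  have e2 : fourierCoeff (fun β => φ (circlePoint β)) k = circleCoeff φ k := rfl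
  rw [e1, e2]
  push_cast
  rw [← Complex.conj_mul']
  simp only [map_mul, Complex.conj_I, map_intCast]
  linear_combination (Real.pi * k * (starRingEnd ℂ) (circleCoeff φ k) * circleCoeff φ k) *
    Complex.I_sq

/-! ### Comparison of the `L²` norms on the disc and on the circle. -/

/-- The divergence theorem for the field `z|φ|²`, whose normal component on the circle is `|φ|²`. -/
lemma integral_radial {φ : ℂ → ℂ} (hφ : ContDiff ℝ ∞ φ) :
    2 * Real.pi * ∫ β, ‖φ (circlePoint β)‖ ^ 2 ∂AddCircle.haarAddCircle =
      ∫ z, (2 * ‖φ z‖ ^ 2 + 2 * ((starRingEnd ℂ) (φ z) * fderiv ℝ φ z z).re) ∂discMeasure := by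
  set h : ℂ → ℂ := fun z => (starRingEnd ℂ) (φ z) * φ z with hh
  have hs : ContDiff ℝ ∞ h := (contDiff_conj hφ).mul hφ
  have hre : ContDiff ℝ ∞ fun z : ℂ => (z.re : ℂ) :=
    Complex.ofRealCLM.contDiff.comp Complex.reCLM.contDiff
  have him : ContDiff ℝ ∞ fun z : ℂ => (z.im : ℂ) :=
    Complex.ofRealCLM.contDiff.comp Complex.imCLM.contDiff
  have h1 := integral_disc_fderiv (fun z => (z.re : ℂ) * h z) ((hre.mul hs).of_le (by simp)) 1
  have h2 := integral_disc_fderiv (fun z => (z.im : ℂ) * h z)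
    ((him.mul hs).of_le (by simp)) Complex.I
  have d1 : ∀ z, fderiv ℝ (fun z => (z.re : ℂ) * h z) z 1 = h z + z.re * fderiv ℝ h z 1 := by
    intro z
    have k : HasFDerivAt (fun z : ℂ => (z.re : ℂ)) (Complex.ofRealCLM.comp Complex.reCLM) z :=
      (Complex.ofRealCLM.comp Complex.reCLM).hasFDerivAt
    rw [fderiv_fun_mul k.differentiableAt (hs.differentiable (by simp) z), k.fderiv]
    simp
    ring
  have d2 : ∀ z, fderiv ℝ (fun z => (z.im : ℂ) * h z) z Complex.I =
      h z + z.im * fderiv ℝ h z Complex.I := by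
    intro z
    have k : HasFDerivAt (fun z : ℂ => (z.im : ℂ)) (Complex.ofRealCLM.comp Complex.imCLM) z :=
      (Complex.ofRealCLM.comp Complex.imCLM).hasFDerivAt
    rw [fderiv_fun_mul k.differentiableAt (hs.differentiable (by simp) z), k.fderiv]
    simp
    ring
  have d3 : ∀ z, fderiv ℝ h z z = z.re * fderiv ℝ h z 1 + z.im * fderiv ℝ h z Complex.I := by
    intro z
    have : z = z.re • (1 : ℂ) + z.im • Complex.I := by apply Complex.ext <;> simp
    conv_lhs => rw [this, map_add, map_smul, map_smul]
    simp
  have d4 : ∀ z, fderiv ℝ h z z = ((2 * ((starRingEnd ℂ) (φ z) * fderiv ℝ φ z z).re : ℝ) : ℂ) := by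
    intro z
    rw [hh, fderiv_fun_mul ((contDiff_conj hφ).differentiable (by simp) z)
      (hφ.differentiable (by simp) z)]
    simp only [add_apply, smul_apply, fderiv_conj hφ,
      smul_eq_mul]
    have := Complex.add_conj ((starRingEnd ℂ) (φ z) * fderiv ℝ φ z z)
    rw [map_mul, Complex.conj_conj] at this
    exact this
  have d5 : ∀ z, h z = ((‖φ z‖ ^ 2 : ℝ) : ℂ) := by
    intro z
    rw [hh, Complex.ofReal_pow, ← Complex.conj_mul']
  have hc1 := integrable_disc (continuous_fderiv_const (hre.mul hs) 1)
  have hc2 := integrable_disc (continuous_fderiv_const (him.mul hs) Complex.I)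
  have key := congrArg₂ (fun x y : ℂ => x + y) h1 h2
  beta_reduce at key
  rw [← integral_add hc1 hc2, ← mul_add, ← integral_add] at key
  · apply Complex.ofReal_injective
    push_cast
    rw [← integral_complex_ofReal, ← integral_complex_ofReal]
    refine Eq.trans ?_ (key.symm.trans ?_)
    · congr 2
      ext β
      have hn : (circlePoint β).re * (circlePoint β).re + (circlePoint β).im * (circlePoint β).im
          = 1 := by
        rw [← Complex.normSq_apply, Complex.normSq_eq_norm_sq, norm_circlePoint, one_pow]
      rw [← d5]
      have hn' : ((circlePoint β).re : ℂ) * (circlePoint β).re +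
        (circlePoint β).im * (circlePoint β).im = 1 := by exact_mod_cast hn
      simp
      linear_combination -(h (circlePoint β)) * hn'
    · congr 1
      ext z
      rw [d1, d2]
      push_cast
      have := d4 z
      push_cast at this
      have d5' := d5 z
      push_cast at d5'
      rw [← this, ← d5', d3]
      ring
  · refine integrable_circle ?_
    refine (Complex.continuous_ofReal.comp (Complex.continuous_re.comp (continuous_const.mul
      (Complex.continuous_conj.comp continuous_circlePoint)))).mul ?_
    exact continuous_comp_circlePoint (hre.mul hs).continuous
  · refine integrable_circle ?_
    refine (Complex.continuous_ofReal.comp (Complex.continuous_re.comp (continuous_const.mul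
      (Complex.continuous_conj.comp continuous_circlePoint)))).mul ?_
    exact continuous_comp_circlePoint (him.mul hs).continuous

lemma abs_radial_le (φ : ℂ → ℂ) {z : ℂ} (hz : ‖z‖ ≤ 1) :
    |2 * ((starRingEnd ℂ) (φ z) * fderiv ℝ φ z z).re| ≤
      ‖φ z‖ ^ 2 + (‖fderiv ℝ φ z 1‖ ^ 2 + ‖fderiv ℝ φ z Complex.I‖ ^ 2) := by
  have h1 : ‖fderiv ℝ φ z z‖ ≤ |z.re| * ‖fderiv ℝ φ z 1‖ + |z.im| * ‖fderiv ℝ φ z Complex.I‖ := by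
    have : z = z.re • (1 : ℂ) + z.im • Complex.I := by apply Complex.ext <;> simp
    conv_lhs => rw [this, map_add, map_smul, map_smul]
    refine (norm_add_le _ _).trans ?_
    conv_lhs => rw [← this]
    rw [norm_smul, norm_smul, Real.norm_eq_abs, Real.norm_eq_abs]
  have h2 : |z.re| ^ 2 + |z.im| ^ 2 ≤ 1 := by
    rw [sq_abs, sq_abs, pow_two, pow_two, ← Complex.normSq_apply, Complex.normSq_eq_norm_sq]
    exact pow_le_one₀ (norm_nonneg _) hz
  have h3 : |((starRingEnd ℂ) (φ z) * fderiv ℝ φ z z).re| ≤ ‖φ z‖ * ‖fderiv ℝ φ z z‖ := by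
    refine (Complex.abs_re_le_norm _).trans ?_
    rw [norm_mul, RCLike.norm_conj]
  rw [abs_mul, abs_two]
  set a := |z.re|
  set b := |z.im|
  set X := ‖fderiv ℝ φ z 1‖
  set Y := ‖fderiv ℝ φ z Complex.I‖
  set D := ‖fderiv ℝ φ z z‖ with hD
  have hD0 : 0 ≤ D := norm_nonneg _
  have h4 : D ^ 2 ≤ X ^ 2 + Y ^ 2 := by
    have : D ^ 2 ≤ (a * X + b * Y) ^ 2 := pow_le_pow_left₀ hD0 h1 2
    nlinarith [sq_nonneg (a * Y - b * X), sq_nonneg X, sq_nonneg Y]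
  nlinarith [sq_nonneg (‖φ z‖ - D)]

/-- Both signs matter: one bounds the trace by the `H¹` norm, the other gives Poincaré, since the
coefficient `2 = div z` exceeds the `1` on the right. -/
lemma abs_circle_sub_disc_le {φ : ℂ → ℂ} (hφ : ContDiff ℝ ∞ φ) :
    |2 * Real.pi * ∫ β, ‖φ (circlePoint β)‖ ^ 2 ∂AddCircle.haarAddCircle -
      2 * ∫ z, ‖φ z‖ ^ 2 ∂discMeasure| ≤ ∫ z, ‖φ z‖ ^ 2 ∂discMeasure +
        (∫ z, ‖fderiv ℝ φ z 1‖ ^ 2 ∂discMeasure +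
          ∫ z, ‖fderiv ℝ φ z Complex.I‖ ^ 2 ∂discMeasure) := by
  have hc : Continuous fun z => 2 * ((starRingEnd ℂ) (φ z) * fderiv ℝ φ z z).re :=
    continuous_const.mul (Complex.continuous_re.comp ((contDiff_conj hφ).continuous.mul
      ((hφ.continuous_fderiv (by simp)).clm_apply continuous_id)))
  have i1 := integrable_norm_sq hφ.continuous
  have i2 := integrable_norm_sq (continuous_fderiv_const hφ 1)
  have i3 := integrable_norm_sq (continuous_fderiv_const hφ Complex.I)
  have i4 : Integrable (fun z => ‖fderiv ℝ φ z 1‖ ^ 2 + ‖fderiv ℝ φ z Complex.I‖ ^ 2)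
    discMeasure := i2.add i3
  rw [integral_radial hφ, integral_add (i1.const_mul 2) (integrable_disc_real hc),
    integral_const_mul, add_sub_cancel_left, ← integral_add i2 i3,
    ← integral_add i1 i4]
  refine (abs_integral_le_integral_abs).trans ?_
  refine integral_mono_ae (integrable_disc_real hc).abs (i1.add i4) ?_
  rw [discMeasure, disc]
  refine (ae_restrict_iff' Metric.isOpen_ball.measurableSet).2 (ae_of_all _ fun z hz => ?_)
  exact abs_radial_le φ (mem_ball_zero_iff.1 hz).le

/-! ### Boundary estimates for smooth functions, in terms of `L²` norms. -/

section SmoothEstimates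

variable {φ : ℂ → ℂ} (hφ : ContDiff ℝ ∞ φ)

/-- A smooth function as an element of `L²(Ω)`. -/
def smoothVal (hφ : ContDiff ℝ ∞ φ) : L2 := ofCont φ hφ.continuous

/-- A directional derivative of a smooth function as an element of `L²(Ω)`. -/
def smoothDeriv (hφ : ContDiff ℝ ∞ φ) (e : ℂ) : L2 :=
  ofCont (fun z => fderiv ℝ φ z e) (continuous_fderiv_const hφ e)

/-- The restriction to the circle of a smooth function as an element of `L²(Γ)`. -/
def smoothTrace (hφ : ContDiff ℝ ∞ φ) : L2Circle :=
  circleOfCont _ (continuous_comp_circlePoint hφ.continuous)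

lemma ofCont_dz : ofCont (dz φ) (continuous_dz hφ) =
    (1 / 2 : ℂ) • (smoothDeriv hφ 1 - Complex.I • smoothDeriv hφ Complex.I) := by
  apply Lp.ext
  filter_upwards [coeFn_ofCont (continuous_dz hφ), coeFn_ofCont (continuous_fderiv_const hφ 1),
    coeFn_ofCont (continuous_fderiv_const hφ Complex.I),
    Lp.coeFn_smul (1 / 2 : ℂ) (smoothDeriv hφ 1 - Complex.I • smoothDeriv hφ Complex.I),
    Lp.coeFn_sub (smoothDeriv hφ 1) (Complex.I • smoothDeriv hφ Complex.I),
    Lp.coeFn_smul Complex.I (smoothDeriv hφ Complex.I)] with z h1 h2 h3 h4 h5 h6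
  rw [h1, h4, Pi.smul_apply, h5, Pi.sub_apply, h6, Pi.smul_apply, smoothDeriv, smoothDeriv, h2, h3]
  rfl

lemma ofCont_dzbar : ofCont (dzbar φ) (continuous_dzbar hφ) =
    (1 / 2 : ℂ) • (smoothDeriv hφ 1 + Complex.I • smoothDeriv hφ Complex.I) := by
  apply Lp.ext
  filter_upwards [coeFn_ofCont (continuous_dzbar hφ), coeFn_ofCont (continuous_fderiv_const hφ 1),
    coeFn_ofCont (continuous_fderiv_const hφ Complex.I),
    Lp.coeFn_smul (1 / 2 : ℂ) (smoothDeriv hφ 1 + Complex.I • smoothDeriv hφ Complex.I),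
    Lp.coeFn_add (smoothDeriv hφ 1) (Complex.I • smoothDeriv hφ Complex.I),
    Lp.coeFn_smul Complex.I (smoothDeriv hφ Complex.I)] with z h1 h2 h3 h4 h5 h6
  rw [h1, h4, Pi.smul_apply, h5, Pi.add_apply, h6, Pi.smul_apply, smoothDeriv, smoothDeriv, h2, h3]
  rfl

lemma abs_smoothTrace_sub_le :
    |2 * Real.pi * ‖smoothTrace hφ‖ ^ 2 - 2 * ‖smoothVal hφ‖ ^ 2| ≤
      ‖smoothVal hφ‖ ^ 2 + (‖smoothDeriv hφ 1‖ ^ 2 + ‖smoothDeriv hφ Complex.I‖ ^ 2) := by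
  rw [smoothTrace, smoothVal, smoothDeriv, smoothDeriv, norm_sq_circleOfCont, norm_sq_ofCont,
    norm_sq_ofCont, norm_sq_ofCont]
  exact abs_circle_sub_disc_le hφ

lemma norm_sq_smoothTrace_le :
    ‖smoothTrace hφ‖ ^ 2 ≤
      ‖smoothVal hφ‖ ^ 2 + ‖smoothDeriv hφ 1‖ ^ 2 + ‖smoothDeriv hφ Complex.I‖ ^ 2 := by
  have h := (abs_le.1 (abs_smoothTrace_sub_le hφ)).2
  have := Real.pi_gt_three
  nlinarith [sq_nonneg ‖smoothTrace hφ‖, sq_nonneg ‖smoothVal hφ‖,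
    sq_nonneg ‖smoothDeriv hφ 1‖, sq_nonneg ‖smoothDeriv hφ Complex.I‖]

lemma norm_sq_smoothVal_le :
    ‖smoothVal hφ‖ ^ 2 ≤ 2 * Real.pi * ‖smoothTrace hφ‖ ^ 2 +
      (‖smoothDeriv hφ 1‖ ^ 2 + ‖smoothDeriv hφ Complex.I‖ ^ 2) := by
  have h := (abs_le.1 (abs_smoothTrace_sub_le hφ)).1
  linarith

lemma fourierCoeff_smoothTrace (k : ℤ) : fourierCoeff (smoothTrace hφ) k = circleCoeff φ k :=
  fourierCoeff_circleOfCont _ k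

lemma hHalfTerm_nonneg (g : L2Circle) (k : ℤ) : 0 ≤ hHalfTerm g k := by
  unfold hHalfTerm
  positivity

lemma abs_le_hHalfWeight (k : ℤ) : |(k : ℝ)| ≤ (1 + (k : ℝ) ^ 2) ^ (1 / 2 : ℝ) := by
  rw [← Real.sqrt_eq_rpow]
  exact Real.abs_le_sqrt (by linarith)

lemma one_le_hHalfWeight (k : ℤ) : 1 ≤ (1 + (k : ℝ) ^ 2) ^ (1 / 2 : ℝ) := by
  rw [← Real.sqrt_eq_rpow]
  exact Real.one_le_sqrt.2 (by nlinarith [sq_nonneg (k : ℝ)])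

lemma hHalfWeight_le (k : ℤ) : (1 + (k : ℝ) ^ 2) ^ (1 / 2 : ℝ) ≤ 1 + |(k : ℝ)| := by
  rw [← Real.sqrt_eq_rpow]
  refine Real.sqrt_le_iff.2 ⟨by positivity, ?_⟩
  rw [add_sq, sq_abs]
  nlinarith [abs_nonneg (k : ℝ)]

lemma norm_sq_half_add_sub (X Y : L2) :
    ‖(1 / 2 : ℂ) • (X - Complex.I • Y)‖ ^ 2 + ‖(1 / 2 : ℂ) • (X + Complex.I • Y)‖ ^ 2 =
      (1 / 2) * (‖X‖ ^ 2 + ‖Y‖ ^ 2) := by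
  have h := parallelogram_law_with_norm ℂ X (Complex.I • Y)
  have hI : ‖Complex.I • Y‖ = ‖Y‖ := by rw [norm_smul, Complex.norm_I, one_mul]
  rw [hI] at h
  rw [norm_smul, norm_smul]
  have : ‖(1 / 2 : ℂ)‖ = 1 / 2 := by norm_num
  rw [this]
  nlinarith

lemma summable_sq_fourierCoeff (g : L2Circle) : Summable fun k => ‖fourierCoeff g k‖ ^ 2 :=
  (hasSum_sq_fourierCoeff g).summable

lemma tsum_sq_fourierCoeff_eq (g : L2Circle) : ∑' k, ‖fourierCoeff g k‖ ^ 2 = ‖g‖ ^ 2 := by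
  rw [tsum_sq_fourierCoeff]
  have h := inner_self_eq_norm_sq_to_K (𝕜 := ℂ) g
  rw [L2.inner_def] at h
  have h2 : ∀ z, inner ℂ (g z) (g z) = ((‖g z‖ ^ 2 : ℝ) : ℂ) := by
    intro z
    rw [inner_self_eq_norm_sq_to_K]
    push_cast
    rfl
  simp_rw [h2] at h
  rw [integral_complex_ofReal] at h
  exact Complex.ofReal_injective (h.trans (Complex.ofReal_pow _ _).symm)

/-- The weight is at most `1 + |k|`: the `1` is paid for by the `L²` trace bound and the `|k|` by
Bessel. Since `π > 3`, no constant is left on the right. Finite sums yield summability and pass to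
limits in `L²(Γ)`. -/
lemma sum_hHalfTerm_smoothTrace_le (S : Finset ℤ) :
    ∑ k ∈ S, hHalfTerm (smoothTrace hφ) k ≤
      ‖smoothVal hφ‖ ^ 2 + ‖smoothDeriv hφ 1‖ ^ 2 + ‖smoothDeriv hφ Complex.I‖ ^ 2 := by
  have h1 : ∑ k ∈ S, ‖fourierCoeff (smoothTrace hφ) k‖ ^ 2 ≤ ‖smoothTrace hφ‖ ^ 2 := by
    rw [← tsum_sq_fourierCoeff_eq]
    exact (summable_sq_fourierCoeff _).sum_le_tsum S (fun _ _ => sq_nonneg _)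
  have h2 := sum_circleCoeff_le hφ S
  rw [← norm_sq_ofCont (continuous_dz hφ), ← norm_sq_ofCont (continuous_dzbar hφ), ofCont_dz hφ,
    ofCont_dzbar hφ, norm_sq_half_add_sub] at h2
  have h3 : ∑ k ∈ S, hHalfTerm (smoothTrace hφ) k ≤
      ∑ k ∈ S, ‖fourierCoeff (smoothTrace hφ) k‖ ^ 2 +
        ∑ k ∈ S, |(k : ℝ)| * ‖fourierCoeff (smoothTrace hφ) k‖ ^ 2 := by
    rw [← Finset.sum_add_distrib]
    refine Finset.sum_le_sum fun k _ => ?_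
    rw [hHalfTerm]
    nlinarith [hHalfWeight_le k, sq_nonneg ‖fourierCoeff (smoothTrace hφ) k‖]
  simp_rw [mul_assoc] at h2
  rw [← Finset.mul_sum] at h2
  simp_rw [← fourierCoeff_smoothTrace hφ] at h2
  have h4 := (abs_le.1 (abs_smoothTrace_sub_le hφ)).2
  have := Real.pi_gt_three
  set A := ∑ k ∈ S, |(k : ℝ)| * ‖fourierCoeff (smoothTrace hφ) k‖ ^ 2 with hA
  have hA0 : 0 ≤ A := Finset.sum_nonneg fun k _ => by positivity
  nlinarith [sq_nonneg ‖smoothTrace hφ‖, sq_nonneg ‖smoothVal hφ‖,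
    sq_nonneg ‖smoothDeriv hφ 1‖, sq_nonneg ‖smoothDeriv hφ Complex.I‖]

lemma memHHalf_smoothTrace : MemHHalf (smoothTrace hφ) :=
  summable_of_sum_le (hHalfTerm_nonneg _) (sum_hHalfTerm_smoothTrace_le hφ)

lemma abs_green_le :
    |‖(1 / 2 : ℂ) • (smoothDeriv hφ 1 - Complex.I • smoothDeriv hφ Complex.I)‖ ^ 2 -
      ‖(1 / 2 : ℂ) • (smoothDeriv hφ 1 + Complex.I • smoothDeriv hφ Complex.I)‖ ^ 2| ≤
      Real.pi * hHalfNormSq (smoothTrace hφ) := by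
  have h := hasSum_green hφ
  rw [← norm_sq_ofCont (continuous_dz hφ), ← norm_sq_ofCont (continuous_dzbar hφ), ofCont_dz hφ,
    ofCont_dzbar hφ] at h
  have hs := (memHHalf_smoothTrace hφ).mul_left Real.pi
  rw [← h.tsum_eq, hHalfNormSq, ← tsum_mul_left, ← Real.norm_eq_abs]
  refine tsum_of_norm_bounded hs.hasSum fun k => ?_
  rw [hHalfTerm, fourierCoeff_smoothTrace, norm_mul, norm_mul, Real.norm_of_nonneg Real.pi_pos.le,
    Real.norm_eq_abs, Real.norm_of_nonneg (sq_nonneg _)]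
  gcongr
  exact abs_le_hHalfWeight k

end SmoothEstimates

/-! ### Passage to the limit: estimates for traces of `H¹` functions. -/

section TraceEstimates

lemma ofCont_sub {φ ψ : ℂ → ℂ} (hφ : Continuous φ) (hψ : Continuous ψ) :
    ofCont (fun z => φ z - ψ z) (hφ.sub hψ) = ofCont φ hφ - ofCont ψ hψ := rfl

lemma smoothVal_sub {φ ψ : ℂ → ℂ} (hφ : ContDiff ℝ ∞ φ) (hψ : ContDiff ℝ ∞ ψ) :
    smoothVal (hφ.sub hψ) = smoothVal hφ - smoothVal hψ := rfl

lemma smoothTrace_sub {φ ψ : ℂ → ℂ} (hφ : ContDiff ℝ ∞ φ) (hψ : ContDiff ℝ ∞ ψ) :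
    smoothTrace (hφ.sub hψ) = smoothTrace hφ - smoothTrace hψ := rfl

lemma smoothDeriv_sub {φ ψ : ℂ → ℂ} (hφ : ContDiff ℝ ∞ φ) (hψ : ContDiff ℝ ∞ ψ) (e : ℂ) :
    smoothDeriv (hφ.sub hψ) e = smoothDeriv hφ e - smoothDeriv hψ e := by
  rw [smoothDeriv, smoothDeriv, smoothDeriv, ← ofCont_sub]
  congr 1
  ext z
  rw [fderiv_fun_sub (hφ.differentiable (by simp) z) (hψ.differentiable (by simp) z)]
  rfl

lemma tendsto_ofCont_iff {φ : ℕ → ℂ → ℂ} (hφ : ∀ n, Continuous (φ n)) (u : L2) :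
    Tendsto (fun n => eLpNorm (fun z => φ n z - u z) 2 discMeasure) atTop (𝓝 0) ↔
      Tendsto (fun n => ofCont (φ n) (hφ n)) atTop (𝓝 u) := by
  rw [Lp.tendsto_Lp_iff_tendsto_eLpNorm']
  refine tendsto_congr fun n => eLpNorm_congr_ae ?_
  filter_upwards [coeFn_ofCont (hφ n)] with z hz
  rw [Pi.sub_apply, hz]

lemma tendsto_circleOfCont_iff {f : ℕ → AddCircle (2 * Real.pi) → ℂ} (hf : ∀ n, Continuous (f n))
    (g : L2Circle) :
    Tendsto (fun n => eLpNorm (fun β => f n β - g β) 2 AddCircle.haarAddCircle) atTop (𝓝 0) ↔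
      Tendsto (fun n => circleOfCont (f n) (hf n)) atTop (𝓝 g) := by
  rw [Lp.tendsto_Lp_iff_tendsto_eLpNorm']
  refine tendsto_congr fun n => eLpNorm_congr_ae ?_
  filter_upwards [coeFn_circleOfCont (hf n)] with z hz
  rw [Pi.sub_apply, hz]

/-- The definition of the trace, in terms of convergence in the spaces `L²`. -/
lemma isTrace_iff (u : L2) (g : L2Circle) : IsTrace u g ↔
    ∃ (φ : ℕ → ℂ → ℂ) (hφ : ∀ n, ContDiff ℝ ∞ (φ n)),
      Tendsto (fun n => smoothVal (hφ n)) atTop (𝓝 u) ∧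
      Tendsto (fun n => smoothDeriv (hφ n) 1) atTop (𝓝 (weakDeriv 1 u)) ∧
      Tendsto (fun n => smoothDeriv (hφ n) Complex.I) atTop (𝓝 (weakDeriv Complex.I u)) ∧
      Tendsto (fun n => smoothTrace (hφ n)) atTop (𝓝 g) := by
  unfold IsTrace
  refine exists_congr fun φ => ?_
  rw [← exists_prop]
  refine exists_congr fun hφ => ?_
  rw [tendsto_ofCont_iff fun n => (hφ n).continuous,
    tendsto_ofCont_iff fun n => continuous_fderiv_const (hφ n) 1,
    tendsto_ofCont_iff fun n => continuous_fderiv_const (hφ n) Complex.I,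
    tendsto_circleOfCont_iff fun n => continuous_comp_circlePoint (hφ n).continuous]
  rfl

lemma fourierCoeff_add_Lp (x y : L2Circle) (k : ℤ) :
    fourierCoeff ((x + y : L2Circle) : AddCircle (2 * Real.pi) → ℂ) k =
      fourierCoeff x k + fourierCoeff y k := by
  rw [← fourierBasis_repr, ← fourierBasis_repr, ← fourierBasis_repr, map_add]
  rfl

lemma continuous_fourierCoeff (k : ℤ) :
    Continuous fun g : L2Circle => fourierCoeff (g : AddCircle (2 * Real.pi) → ℂ) k := by
  simp_rw [← fourierBasis_repr, HilbertBasis.repr_apply_apply]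
  exact continuous_const.inner continuous_id

lemma continuous_hHalfTerm (k : ℤ) : Continuous fun g : L2Circle => hHalfTerm g k :=
  continuous_const.mul ((continuous_fourierCoeff k).norm.pow 2)

/-- Young's inequality. The factor `1 + η` lets the sharp constant `π` in Green's bound survive the
limit, with `η → 0` taken last. -/
lemma hHalfTerm_add_le (x y : L2Circle) (k : ℤ) {η : ℝ} (hη : 0 < η) :
    hHalfTerm (x + y) k ≤ (1 + η) * hHalfTerm x k + (1 + η⁻¹) * hHalfTerm y k := by
  unfold hHalfTerm
  rw [fourierCoeff_add_Lp]
  set a := fourierCoeff (x : AddCircle (2 * Real.pi) → ℂ) k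
  set b := fourierCoeff (y : AddCircle (2 * Real.pi) → ℂ) k
  have h1 : ‖a + b‖ ^ 2 ≤ (‖a‖ + ‖b‖) ^ 2 := pow_le_pow_left₀ (norm_nonneg _) (norm_add_le _ _) 2
  have h2 : 2 * ‖a‖ * ‖b‖ ≤ η * ‖a‖ ^ 2 + η⁻¹ * ‖b‖ ^ 2 := by
    have h3 : 0 ≤ η⁻¹ * (η * ‖a‖ - ‖b‖) ^ 2 := by positivity
    have h4 : η⁻¹ * (η * ‖a‖ - ‖b‖) ^ 2 = η * ‖a‖ ^ 2 + η⁻¹ * ‖b‖ ^ 2 - 2 * ‖a‖ * ‖b‖ := by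
      field_simp
      ring
    linarith
  have hw : 0 ≤ (1 + (k : ℝ) ^ 2) ^ (1 / 2 : ℝ) := by positivity
  nlinarith [mul_le_mul_of_nonneg_left
    (show ‖a + b‖ ^ 2 ≤ (1 + η) * ‖a‖ ^ 2 + (1 + η⁻¹) * ‖b‖ ^ 2 by nlinarith) hw]

variable {u : L2} {g : L2Circle}

lemma IsTrace.sum_hHalfTerm_le (h : IsTrace u g) (S : Finset ℤ) :
    ∑ k ∈ S, hHalfTerm g k ≤ h1NormSq u := by
  obtain ⟨φ, hφ, h1, h2, h3, h4⟩ := (isTrace_iff u g).1 h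
  have hl : Tendsto (fun n => ∑ k ∈ S, hHalfTerm (smoothTrace (hφ n)) k) atTop
      (𝓝 (∑ k ∈ S, hHalfTerm g k)) :=
    ((continuous_finsetSum S fun k _ => continuous_hHalfTerm k).tendsto g).comp h4
  have hr := ((h1.norm.pow 2).add (h2.norm.pow 2)).add (h3.norm.pow 2)
  exact le_of_tendsto_of_tendsto' hl hr fun n => sum_hHalfTerm_smoothTrace_le (hφ n) S

lemma IsTrace.memHHalf (h : IsTrace u g) : MemHHalf g :=
  summable_of_sum_le (hHalfTerm_nonneg _) h.sum_hHalfTerm_le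

lemma IsTrace.hHalfNormSq_le (h : IsTrace u g) : hHalfNormSq g ≤ h1NormSq u :=
  h.memHHalf.tsum_le_of_sum_le h.sum_hHalfTerm_le

lemma hHalfNormSq_nonneg (g : L2Circle) : 0 ≤ hHalfNormSq g := tsum_nonneg (hHalfTerm_nonneg g)

lemma norm_sq_le_hHalfNormSq (hg : MemHHalf g) : ‖g‖ ^ 2 ≤ hHalfNormSq g := by
  rw [← tsum_sq_fourierCoeff_eq, hHalfNormSq]
  refine (summable_sq_fourierCoeff g).tsum_le_tsum (fun k => ?_) hg
  rw [hHalfTerm]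
  exact le_mul_of_one_le_left (sq_nonneg _) (one_le_hHalfWeight k)

/-- Convergence of the traces in `L²(Γ)` does not control `hHalfNormSq`; convergence in `H^{1/2}` is
deduced from the convergence in `H¹`. -/
lemma IsTrace.abs_green_le (h : IsTrace u g) :
    |‖del u‖ ^ 2 - ‖delbar u‖ ^ 2| ≤ Real.pi * hHalfNormSq g := by
  have hg := h.memHHalf
  obtain ⟨φ, hφ, h1, h2, h3, h4⟩ := (isTrace_iff u g).1 h
  set δ : ℕ → ℝ := fun n => ‖smoothVal (hφ n) - u‖ ^ 2 +
    ‖smoothDeriv (hφ n) 1 - weakDeriv 1 u‖ ^ 2 +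
    ‖smoothDeriv (hφ n) Complex.I - weakDeriv Complex.I u‖ ^ 2 with hδ
  have hδ0 : Tendsto δ atTop (𝓝 0) := by
    have hr := (((h1.sub_const u).norm.pow 2).add ((h2.sub_const (weakDeriv 1 u)).norm.pow 2)).add
      ((h3.sub_const (weakDeriv Complex.I u)).norm.pow 2)
    simpa using hr
  -- The smooth trace bound for `φ n - φ m`, with `m → ∞` on a finite set of frequencies.
  have hS : ∀ n (S : Finset ℤ), ∑ k ∈ S, hHalfTerm (smoothTrace (hφ n) - g) k ≤ δ n := by
    intro n S
    have hl : Tendsto (fun m => ∑ k ∈ S, hHalfTerm (smoothTrace (hφ n) - smoothTrace (hφ m)) k)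
        atTop (𝓝 (∑ k ∈ S, hHalfTerm (smoothTrace (hφ n) - g) k)) :=
      ((continuous_finsetSum S fun k _ => continuous_hHalfTerm k).tendsto _).comp
        (h4.const_sub (smoothTrace (hφ n)))
    have hr := (((h1.const_sub (smoothVal (hφ n))).norm.pow 2).add
      ((h2.const_sub (smoothDeriv (hφ n) 1)).norm.pow 2)).add
      ((h3.const_sub (smoothDeriv (hφ n) Complex.I)).norm.pow 2)
    refine le_of_tendsto_of_tendsto' hl hr fun m => ?_
    have := sum_hHalfTerm_smoothTrace_le ((hφ n).sub (hφ m)) S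
    rwa [smoothTrace_sub, smoothVal_sub, smoothDeriv_sub, smoothDeriv_sub] at this
  have hsum : ∀ n, Summable (hHalfTerm (smoothTrace (hφ n) - g)) := fun n =>
    summable_of_sum_le (hHalfTerm_nonneg _) (hS n)
  have hN : ∀ n, hHalfNormSq (smoothTrace (hφ n) - g) ≤ δ n := fun n =>
    (hsum n).tsum_le_of_sum_le (hS n)
  have hD : Tendsto (fun n =>
      |‖(1 / 2 : ℂ) • (smoothDeriv (hφ n) 1 - Complex.I • smoothDeriv (hφ n) Complex.I)‖ ^ 2 -
        ‖(1 / 2 : ℂ) • (smoothDeriv (hφ n) 1 + Complex.I • smoothDeriv (hφ n) Complex.I)‖ ^ 2|)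
      atTop (𝓝 |‖del u‖ ^ 2 - ‖delbar u‖ ^ 2|) :=
    ((((h2.sub (h3.const_smul Complex.I)).const_smul (1 / 2 : ℂ)).norm.pow 2).sub
      (((h2.add (h3.const_smul Complex.I)).const_smul (1 / 2 : ℂ)).norm.pow 2)).abs
  have hη : ∀ η : ℝ, 0 < η →
      |‖del u‖ ^ 2 - ‖delbar u‖ ^ 2| ≤ Real.pi * ((1 + η) * hHalfNormSq g) := by
    intro η hη
    have hr : Tendsto (fun n => Real.pi * ((1 + η) * hHalfNormSq g + (1 + η⁻¹) * δ n)) atTop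
        (𝓝 (Real.pi * ((1 + η) * hHalfNormSq g))) := by
      simpa using ((hδ0.const_mul (1 + η⁻¹)).const_add ((1 + η) * hHalfNormSq g)).const_mul Real.pi
    refine le_of_tendsto_of_tendsto' hD hr fun n => ?_
    refine (BukhgeimBeltrami.abs_green_le (hφ n)).trans ?_
    refine mul_le_mul_of_nonneg_left ?_ Real.pi_pos.le
    have hη' : 0 < 1 + η⁻¹ := by positivity
    refine le_trans ?_ (add_le_add_right (mul_le_mul_of_nonneg_left (hN n) hη'.le) _)
    rw [hHalfNormSq, hHalfNormSq, hHalfNormSq, ← tsum_mul_left, ← tsum_mul_left,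
      ← (hg.mul_left _).tsum_add ((hsum n).mul_left _)]
    refine (memHHalf_smoothTrace (hφ n)).tsum_le_tsum (fun k => ?_)
      ((hg.mul_left _).add ((hsum n).mul_left _))
    have := hHalfTerm_add_le g (smoothTrace (hφ n) - g) k hη
    rwa [add_sub_cancel] at this
  have hlim : Tendsto (fun η : ℝ => Real.pi * ((1 + η) * hHalfNormSq g)) (𝓝[>] 0)
      (𝓝 (Real.pi * hHalfNormSq g)) := by
    have : Tendsto (fun η : ℝ => Real.pi * ((1 + η) * hHalfNormSq g)) (𝓝 0)
        (𝓝 (Real.pi * ((1 + 0) * hHalfNormSq g))) :=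
      Continuous.tendsto (by fun_prop) 0
    rw [add_zero, one_mul] at this
    exact this.mono_left nhdsWithin_le_nhds
  exact ge_of_tendsto hlim (eventually_mem_nhdsWithin.mono fun η h => hη η h)

/-- The gradient term equals `2(‖∂u‖² + ‖∂̄u‖²)`, and Green's bound trades `∂̄u` for `∂u` at the
cost of `2π` times the boundary norm; the radial identity contributes the other `2π`. -/
lemma IsTrace.norm_sq_le (h : IsTrace u g) :
    ‖u‖ ^ 2 ≤ 4 * ‖del u‖ ^ 2 + 4 * Real.pi * hHalfNormSq g := by
  have hG := h.abs_green_le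
  have hT := norm_sq_le_hHalfNormSq h.memHHalf
  obtain ⟨φ, hφ, h1, h2, h3, h4⟩ := (isTrace_iff u g).1 h
  have hu : ‖u‖ ^ 2 ≤ 2 * Real.pi * ‖g‖ ^ 2 +
      (‖weakDeriv 1 u‖ ^ 2 + ‖weakDeriv Complex.I u‖ ^ 2) :=
    le_of_tendsto_of_tendsto' (h1.norm.pow 2)
      (((h4.norm.pow 2).const_mul (2 * Real.pi)).add ((h2.norm.pow 2).add (h3.norm.pow 2)))
      fun n => norm_sq_smoothVal_le (hφ n)
  have hsum : ‖del u‖ ^ 2 + ‖delbar u‖ ^ 2 =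
      (1 / 2) * (‖weakDeriv 1 u‖ ^ 2 + ‖weakDeriv Complex.I u‖ ^ 2) :=
    norm_sq_half_add_sub _ _
  have := (abs_le.1 hG).1
  have := mul_le_mul_of_nonneg_left hT Real.pi_pos.le
  linarith

/-- Smooth functions that converge in `H¹(Ω)` have convergent boundary values. -/
lemma exists_isTrace_of_tendsto {φ : ℕ → ℂ → ℂ} (hφ : ∀ n, ContDiff ℝ ∞ (φ n))
    (h1 : Tendsto (fun n => smoothVal (hφ n)) atTop (𝓝 u))
    (h2 : Tendsto (fun n => smoothDeriv (hφ n) 1) atTop (𝓝 (weakDeriv 1 u)))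
    (h3 : Tendsto (fun n => smoothDeriv (hφ n) Complex.I) atTop (𝓝 (weakDeriv Complex.I u))) :
    ∃ g, IsTrace u g := by
  have hc : CauchySeq fun n => smoothTrace (hφ n) := by
    have c1 := (cauchySeq_iff_tendsto_dist_atTop_0.1 h1.cauchySeq)
    have c2 := (cauchySeq_iff_tendsto_dist_atTop_0.1 h2.cauchySeq)
    have c3 := (cauchySeq_iff_tendsto_dist_atTop_0.1 h3.cauchySeq)
    rw [cauchySeq_iff_tendsto_dist_atTop_0]
    have c4 := (((c1.pow 2).add (c2.pow 2)).add (c3.pow 2)).sqrt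
    rw [show √((0 : ℝ) ^ 2 + 0 ^ 2 + 0 ^ 2) = 0 by norm_num] at c4
    refine squeeze_zero (fun _ => dist_nonneg) (fun p => ?_) c4
    refine Real.le_sqrt_of_sq_le ?_
    have := norm_sq_smoothTrace_le ((hφ p.1).sub (hφ p.2))
    rwa [smoothTrace_sub, smoothVal_sub, smoothDeriv_sub, smoothDeriv_sub, ← dist_eq_norm,
      ← dist_eq_norm, ← dist_eq_norm, ← dist_eq_norm] at this
  obtain ⟨g, hg⟩ := cauchySeq_tendsto_of_complete hc
  exact ⟨g, (isTrace_iff u g).2 ⟨φ, hφ, h1, h2, h3, hg⟩⟩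

end TraceEstimates

/-! ### Density in `H¹(Ω)` of functions smooth up to the boundary. -/

section Mollification

open Convolution ContinuousLinearMap

lemma measurableSet_disc : MeasurableSet disc := Metric.isOpen_ball.measurableSet

/-- Mollification of a function on `Ω`, extended by zero, followed by a dilation by `r`. -/
def mollify (b : ContDiffBump (0 : ℂ)) (r : ℝ) (h : ℂ → ℂ) (z : ℂ) : ℂ :=
  (disc.indicator h ⋆[(lsmul ℝ ℝ).flip, volume] b.normed volume) (r • z)

variable (b : ContDiffBump (0 : ℂ)) (r : ℝ) {h : ℂ → ℂ}

lemma mollify_eq (h : ℂ → ℂ) (z : ℂ) :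
    mollify b r h z = ∫ y, b.normed volume (r • z - y) • h y ∂discMeasure := by
  rw [mollify, convolution_def, discMeasure, ← integral_indicator measurableSet_disc]
  congr 1
  ext y
  by_cases hy : y ∈ disc
  · simp [hy]
  · simp [hy]

lemma locallyIntegrable_indicator (hh : Integrable h discMeasure) :
    LocallyIntegrable (disc.indicator h) volume :=
  ((integrable_indicator_iff measurableSet_disc).2 hh).locallyIntegrable

lemma contDiff_mollify (hh : Integrable h discMeasure) : ContDiff ℝ ∞ (mollify b r h) := by
  have := (b.hasCompactSupport_normed (μ := volume)).contDiff_convolution_right (μ := volume) (n := ⊤)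
    (lsmul ℝ ℝ).flip (locallyIntegrable_indicator hh) b.contDiff_normed
  exact this.comp (contDiff_const_smul r)

lemma fderiv_mollify (hh : Integrable h discMeasure) (z e : ℂ) :
    fderiv ℝ (mollify b r h) z e =
      r • ∫ y, (fderiv ℝ (b.normed volume) (r • z - y) e) • h y ∂discMeasure := by
  have h1 := (b.hasCompactSupport_normed (μ := volume)).hasFDerivAt_convolution_right (μ := volume)
    (lsmul ℝ ℝ).flip (locallyIntegrable_indicator hh) (b.contDiff_normed (n := 1)) (r • z)
  have h2 : HasFDerivAt (fun z : ℂ => r • z) (r • ContinuousLinearMap.id ℝ ℂ) z :=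
    (r • ContinuousLinearMap.id ℝ ℂ).hasFDerivAt
  have h3 : HasFDerivAt (mollify b r h) _ z := h1.comp z h2
  rw [h3.fderiv]
  simp only [comp_apply, smul_apply, id_apply, map_smul]
  congr 1
  rw [convolution_precompR_apply _ (locallyIntegrable_indicator hh)
    (b.hasCompactSupport_normed.fderiv ℝ)
    ((b.contDiff_normed (n := 1)).continuous_fderiv (by simp)), convolution_def, discMeasure,
    ← integral_indicator measurableSet_disc]
  congr 1
  ext y
  by_cases hy : y ∈ disc
  · simp [hy]
  · simp [hy]

lemma closedBall_dilate_subset_disc {z : ℂ} (hz : z ∈ disc) {ε : ℝ} (hr : 0 < r)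
    (hε : ε + r ≤ 1) : Metric.closedBall (r • z) ε ⊆ disc := by
  intro y hy
  rw [mem_closedBall_iff_norm] at hy
  have hz' : ‖z‖ < 1 := mem_ball_zero_iff.1 hz
  refine mem_ball_zero_iff.2 ?_
  calc ‖y‖ = ‖(y - r • z) + r • z‖ := by rw [sub_add_cancel]
    _ ≤ ‖y - r • z‖ + ‖r • z‖ := norm_add_le _ _
    _ ≤ ε + r * ‖z‖ := by
      rw [norm_smul, Real.norm_of_nonneg hr.le]
      linarith
    _ < 1 := by nlinarith

/-- After the dilation the kernel centred at `r z` is supported inside the disc, so it is an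
admissible test function, even for `z` near the boundary. -/
lemma fderiv_mollify_of_isWeakDeriv {e : ℂ} {u w : L2} (huw : IsWeakDeriv e u w) {z : ℂ}
    (hz : z ∈ disc) (hr : 0 < r) (hbr : b.rOut + r ≤ 1) :
    fderiv ℝ (mollify b r u) z e = r • mollify b r w z := by
  have hu : Integrable u discMeasure := (Lp.memLp u).integrable (by norm_num)
  rw [fderiv_mollify b r hu, mollify_eq]
  congr 1
  set x := r • z with hx
  set ψ : ℂ → ℂ := fun y => ((b.normed volume (x - y) : ℝ) : ℂ) with hψ
  have hκ : ContDiff ℝ ∞ (b.normed volume) := b.contDiff_normed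
  have hs : ContDiff ℝ ∞ ψ :=
    Complex.ofRealCLM.contDiff.comp (hκ.comp (contDiff_const.sub contDiff_id))
  have hsupp : Function.support ψ ⊆ Metric.closedBall x b.rOut := by
    intro y hy
    have : x - y ∈ Function.support (b.normed volume) := by
      intro h0
      exact hy (by rw [hψ]; simp only; rw [h0]; simp)
    rw [b.support_normed_eq, mem_ball_zero_iff] at this
    rw [mem_closedBall_iff_norm, norm_sub_rev]
    exact this.le
  have hts : tsupport ψ ⊆ Metric.closedBall x b.rOut :=
    closure_minimal hsupp Metric.isClosed_closedBall
  have hcs : HasCompactSupport ψ :=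
    HasCompactSupport.of_support_subset_isCompact (isCompact_closedBall x b.rOut) hsupp
  -- The sign from the reflection `x - y` cancels the sign in the definition of the weak derivative.
  have hd : ∀ y, fderiv ℝ ψ y e = -((fderiv ℝ (b.normed volume) (x - y) e : ℝ) : ℂ) := by
    intro y
    have k1 : HasFDerivAt (fun y : ℂ => x - y) (-(ContinuousLinearMap.id ℝ ℂ)) y :=
      (hasFDerivAt_id y).const_sub x
    have k2 := (hκ.differentiable (by simp) (x - y)).hasFDerivAt.comp y k1
    have k3 : HasFDerivAt ψ _ y := Complex.ofRealCLM.hasFDerivAt.comp y k2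
    rw [k3.fderiv]
    simp
  have key := huw ψ hs hcs (hts.trans (closedBall_dilate_subset_disc r hz hr hbr))
  simp_rw [hd, mul_neg] at key
  rw [integral_neg, neg_inj] at key
  simp_rw [Complex.real_smul]
  simp_rw [mul_comm _ (u _), mul_comm _ (w _)]
  exact key

/-- Dilation moves `z` by at most `1 - r`, and the kernel has radius at most `1 - r`. The error is
`η` for the dilation plus `2η` for the averaging. -/
lemma dist_mollify_le {z : ℂ} (hz : z ∈ disc) (hr : 0 < r) (hbr : b.rOut + r ≤ 1)
    (hc : Continuous h) {η : ℝ} (hη : ∀ y, dist y z ≤ 2 * (1 - r) → dist (h y) (h z) ≤ η) :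
    dist (mollify b r h z) (h z) ≤ 3 * η := by
  have hz' : ‖z‖ < 1 := mem_ball_zero_iff.1 hz
  have hb := b.rOut_pos
  have hrz : dist (r • z) z ≤ 1 - r := by
    rw [dist_eq_norm, show r • z - z = (r - 1) • z by rw [sub_smul, one_smul], norm_smul,
      Real.norm_of_nonpos (by linarith)]
    nlinarith [norm_nonneg z]
  have h0 : dist (h (r • z)) (h z) ≤ η := hη _ (by linarith)
  rw [mollify, convolution_flip]
  have hin : ∀ y ∈ Metric.closedBall (r • z) b.rOut, disc.indicator h y = h y := fun y hy =>
    Set.indicator_of_mem (closedBall_dilate_subset_disc r hz hr hbr hy) _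
  refine (dist_triangle _ (h (r • z)) _).trans ?_
  have h1 : dist ((b.normed volume ⋆[lsmul ℝ ℝ, volume] disc.indicator h) (r • z))
      (disc.indicator h (r • z)) ≤ 2 * η := by
    refine b.dist_normed_convolution_le
      (hc.aestronglyMeasurable.indicator measurableSet_disc) fun y hy => ?_
    have hy' := Metric.ball_subset_closedBall hy
    rw [hin _ hy', hin _ (Metric.mem_closedBall_self hb.le)]
    have h2 : dist (h y) (h z) ≤ η := by
      refine hη y ?_
      have := dist_triangle y (r • z) z
      have := Metric.mem_closedBall.1 hy'
      linarith
    have := dist_triangle_right (h y) (h (r • z)) (h z)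
    linarith
  rw [hin _ (Metric.mem_closedBall_self hb.le)] at h1
  linarith

/-- Cauchy–Schwarz after splitting `κ g = κ^{1/2} · κ^{1/2} g`. -/
lemma sq_lintegral_mul_le {α : Type*} [MeasurableSpace α] (μ : Measure α) {κ g : α → ℝ≥0∞}
    (hκ : AEMeasurable κ μ) (hg : AEMeasurable g μ) :
    (∫⁻ a, κ a * g a ∂μ) ^ 2 ≤ (∫⁻ a, κ a ∂μ) * ∫⁻ a, κ a * g a ^ 2 ∂μ := by
  have h := ENNReal.lintegral_mul_le_Lp_mul_Lq μ Real.HolderConjugate.two_two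
    (hκ.pow_const (1 / 2 : ℝ)) ((hκ.pow_const (1 / 2 : ℝ)).mul hg)
  have e1 : ∀ a, (κ a ^ (1 / 2 : ℝ)) * (κ a ^ (1 / 2 : ℝ)) = κ a := by
    intro a
    rw [← ENNReal.rpow_add_of_nonneg _ _ (by norm_num) (by norm_num)]
    norm_num
  have e2 : ∀ a, (κ a ^ (1 / 2 : ℝ)) ^ (2 : ℝ) = κ a := by
    intro a
    rw [← ENNReal.rpow_mul]
    norm_num
  simp only [Pi.mul_apply, ← mul_assoc, e1] at h
  simp_rw [ENNReal.mul_rpow_of_nonneg _ _ (zero_le_two : (0 : ℝ) ≤ 2), e2] at h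
  refine (pow_le_pow_left₀ zero_le h 2).trans (le_of_eq ?_)
  have e3 : ∀ x : ℝ≥0∞, (x ^ (1 / 2 : ℝ)) ^ 2 = x := by
    intro x
    rw [← ENNReal.rpow_natCast, ← ENNReal.rpow_mul]
    norm_num
  rw [mul_pow, e3, e3]
  simp

lemma lintegral_normed : ∫⁻ x, ENNReal.ofReal (b.normed volume x) = 1 := by
  rw [← ofReal_integral_eq_lintegral_ofReal b.integrable_normed (ae_of_all _ b.nonneg_normed),
    b.integral_normed, ENNReal.ofReal_one]

lemma lintegral_normed_sub_left (x : ℂ) :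
    ∫⁻ y, ENNReal.ofReal (b.normed volume (x - y)) ∂discMeasure ≤ 1 := by
  refine (lintegral_mono' Measure.restrict_le_self le_rfl).trans (le_of_eq ?_)
  rw [lintegral_sub_left_eq_self (fun y => ENNReal.ofReal (b.normed volume y)) x,
    lintegral_normed]

lemma lintegral_normed_dilate (hr : 1 / 2 ≤ r) (y : ℂ) :
    ∫⁻ z, ENNReal.ofReal (b.normed volume (r • z - y)) ∂discMeasure ≤ 4 := by
  refine (lintegral_mono' Measure.restrict_le_self le_rfl).trans ?_
  have hr0 : r ≠ 0 := by linarith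
  have hm : Measurable fun x => ENNReal.ofReal (b.normed volume (x - y)) :=
    (b.continuous_normed.measurable.comp (measurable_id.sub_const y)).ennreal_ofReal
  have h1 := lintegral_map (μ := (volume : Measure ℂ)) hm (measurable_const_smul r)
  rw [← h1, Measure.map_addHaar_smul volume hr0, lintegral_smul_measure,
    lintegral_sub_right_eq_self (fun y => ENNReal.ofReal (b.normed volume y)) y,
    lintegral_normed, smul_eq_mul, mul_one, Complex.finrank_real_complex]
  rw [show (4 : ℝ≥0∞) = ENNReal.ofReal 4 by simp]
  refine ENNReal.ofReal_le_ofReal ?_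
  rw [abs_of_nonneg (by positivity)]
  refine inv_le_of_inv_le₀ (by norm_num) ?_
  nlinarith

/-- Schur's test: the kernel has mass at most `1` in `y`, and at most `r⁻² ≤ 4` in `z` because of
the dilation; the constant is `√4`. -/
lemma eLpNorm_mollify_le (hr : 1 / 2 ≤ r) (hh : AEStronglyMeasurable h discMeasure) :
    eLpNorm (mollify b r h) 2 discMeasure ≤ 2 * eLpNorm h 2 discMeasure := by
  have hsq : ∀ f : ℂ → ℂ, eLpNorm f 2 discMeasure ^ 2 = ∫⁻ z, ‖f z‖ₑ ^ 2 ∂discMeasure := by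
    intro f
    have := eLpNorm_nnreal_pow_eq_lintegral (μ := discMeasure) (f := f) (p := 2) two_ne_zero
    simpa using this
  rw [← ENNReal.pow_le_pow_left_iff two_ne_zero, mul_pow, hsq, hsq]
  have hb : Measurable (b.normed (volume : Measure ℂ)) := b.continuous_normed.measurable
  have h1 : ∀ z, ‖mollify b r h z‖ₑ ^ 2 ≤
      ∫⁻ y, ENNReal.ofReal (b.normed volume (r • z - y)) * ‖h y‖ₑ ^ 2 ∂discMeasure := by
    intro z
    have k1 : ‖mollify b r h z‖ₑ ≤
        ∫⁻ y, ENNReal.ofReal (b.normed volume (r • z - y)) * ‖h y‖ₑ ∂discMeasure := by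
      rw [mollify_eq]
      refine (enorm_integral_le_lintegral_enorm _).trans (lintegral_mono fun y => ?_)
      rw [enorm_smul, Real.enorm_of_nonneg (b.nonneg_normed _)]
    refine (pow_le_pow_left₀ zero_le k1 2).trans ?_
    refine (sq_lintegral_mul_le discMeasure
      (hb.comp (measurable_const.sub measurable_id)).ennreal_ofReal.aemeasurable hh.enorm).trans ?_
    exact mul_le_of_le_one_left zero_le (lintegral_normed_sub_left b (r • z))
  refine (lintegral_mono h1).trans ?_
  rw [lintegral_lintegral_swap]
  · have h2 : ∀ y, ∫⁻ z, ENNReal.ofReal (b.normed volume (r • z - y)) * ‖h y‖ₑ ^ 2 ∂discMeasure ≤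
        4 * ‖h y‖ₑ ^ 2 := by
      intro y
      rw [lintegral_mul_const]
      · gcongr
        exact lintegral_normed_dilate b r hr y
      · exact (hb.comp ((measurable_const_smul r).sub_const y)).ennreal_ofReal
    refine (lintegral_mono h2).trans (le_of_eq ?_)
    rw [lintegral_const_mul' _ _ (by simp)]
    norm_num
  · have k1 : AEMeasurable (fun p : ℂ × ℂ => ENNReal.ofReal (b.normed volume (r • p.1 - p.2)))
        (discMeasure.prod discMeasure) :=
      (hb.comp ((measurable_fst.const_smul r).sub measurable_snd)).ennreal_ofReal.aemeasurable
    have k2 : AEMeasurable (fun p : ℂ × ℂ => ‖h p.2‖ₑ ^ 2) (discMeasure.prod discMeasure) :=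
      (hh.enorm.comp_quasiMeasurePreserving
        Measure.quasiMeasurePreserving_snd).pow_const 2
    exact k1.mul k2

lemma integrable_mollify_kernel (hh : Integrable h discMeasure) (z : ℂ) :
    Integrable (fun y => b.normed volume (r • z - y) • h y) discMeasure := by
  obtain ⟨C, hC⟩ := b.hasCompactSupport_normed.exists_bound_of_continuous
    (b.continuous_normed (μ := volume))
  refine hh.bdd_smul C ?_ (ae_of_all _ fun y => hC _)
  exact (b.continuous_normed.comp (continuous_const.sub continuous_id)).aestronglyMeasurable

lemma mollify_sub {h' : ℂ → ℂ} (hh : Integrable h discMeasure) (hh' : Integrable h' discMeasure) :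
    mollify b r (h - h') = mollify b r h - mollify b r h' := by
  ext z
  rw [Pi.sub_apply, mollify_eq, mollify_eq, mollify_eq,
    ← integral_sub (integrable_mollify_kernel b r hh z) (integrable_mollify_kernel b r hh' z)]
  simp only [Pi.sub_apply, smul_sub]

/-- The radii of a sequence of mollifiers. -/
def mollRadius (n : ℕ) : ℝ := 1 / ((n : ℝ) + 4)

lemma mollRadius_pos (n : ℕ) : 0 < mollRadius n := by
  unfold mollRadius
  positivity

/-- Keeps the dilation factor `1 - 2 * mollRadius n` at least `1/2`, as `eLpNorm_mollify_le`
requires. -/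
lemma mollRadius_le (n : ℕ) : mollRadius n ≤ 1 / 4 := by
  unfold mollRadius
  gcongr
  linarith [(Nat.cast_nonneg n : (0 : ℝ) ≤ n)]

lemma tendsto_mollRadius : Tendsto mollRadius atTop (𝓝 0) := by
  unfold mollRadius
  exact tendsto_const_nhds.div_atTop
    (tendsto_atTop_add_const_right _ _ tendsto_natCast_atTop_atTop)

/-- A bump function that is supported in a small ball. -/
def mollBump (n : ℕ) : ContDiffBump (0 : ℂ) :=
  ⟨mollRadius n / 2, mollRadius n, half_pos (mollRadius_pos n), half_lt_self (mollRadius_pos n)⟩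

/-- The approximation of a function on `Ω` by functions smooth up to the boundary. -/
def smoothing (n : ℕ) (h : ℂ → ℂ) : ℂ → ℂ := mollify (mollBump n) (1 - 2 * mollRadius n) h

lemma tendsto_smoothing_of_continuous (hc : Continuous h) (hs : HasCompactSupport h) :
    Tendsto (fun n => eLpNorm (smoothing n h - h) 2 discMeasure) atTop (𝓝 0) := by
  rw [ENNReal.tendsto_nhds_zero]
  intro ε hε
  set M : ℝ≥0∞ := discMeasure Set.univ ^ (2 : ℝ≥0∞).toReal⁻¹ with hM
  have hM' : M ≠ ⊤ := ENNReal.rpow_ne_top_of_nonneg (by simp) (measure_ne_top _ _)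
  obtain ⟨η, hη0, hη⟩ : ∃ η : ℝ, 0 < η ∧ M * ENNReal.ofReal (3 * η) ≤ ε := by
    have : Tendsto (fun η : ℝ => M * ENNReal.ofReal (3 * η)) (𝓝[>] 0) (𝓝 0) := by
      have h1 : Tendsto (fun η : ℝ => ENNReal.ofReal (3 * η)) (𝓝 0) (𝓝 (ENNReal.ofReal (3 * 0))) :=
        (ENNReal.continuous_ofReal.comp (continuous_const.mul continuous_id)).tendsto 0
      have h2 := ENNReal.Tendsto.const_mul (a := M) h1 (Or.inr hM')
      simp only [mul_zero, ENNReal.ofReal_zero] at h2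
      exact h2.mono_left nhdsWithin_le_nhds
    have h3 := (ENNReal.tendsto_nhds_zero.1 this ε hε).and self_mem_nhdsWithin
    obtain ⟨η, h4, h5⟩ := h3.exists
    exact ⟨η, h5, h4⟩
  obtain ⟨δ, hδ0, hδ⟩ := Metric.uniformContinuous_iff.1 (hs.uniformContinuous_of_continuous hc) η hη0
  -- With `r = 1 - 2 * mollRadius n`, the distance `2 (1 - r)` in `dist_mollify_le` is `4 *
  -- mollRadius n`.
  have hev := tendsto_mollRadius.eventually (gt_mem_nhds (show (0 : ℝ) < δ / 4 by positivity))
  filter_upwards [hev] with n hn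
  refine le_trans (eLpNorm_le_of_ae_bound (C := 3 * η) ?_) hη
  rw [discMeasure]
  refine (ae_restrict_iff' measurableSet_disc).2 (ae_of_all _ fun z hz => ?_)
  rw [Pi.sub_apply, ← dist_eq_norm]
  have h1 := mollRadius_pos n
  have h2 := mollRadius_le n
  refine dist_mollify_le (mollBump n) _ hz (by linarith) ?_ hc fun y hy => ?_
  · change mollRadius n + _ ≤ 1
    linarith
  · exact (hδ (by linarith)).le

lemma tendsto_smoothing (hh : MemLp h 2 discMeasure) :
    Tendsto (fun n => eLpNorm (smoothing n h - h) 2 discMeasure) atTop (𝓝 0) := by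
  rw [ENNReal.tendsto_nhds_zero]
  intro ε hε
  -- Two quarters go to the smoothing of `h - g`, whose operator bound is `2`; one goes to `g` and
  -- one to `g - h`.
  have hε4 : ε / 4 ≠ 0 := (ENNReal.div_pos hε.ne' (by simp)).ne'
  obtain ⟨g, hgs, hgh, hgc, hgm⟩ := hh.exists_hasCompactSupport_eLpNorm_sub_le (by simp) hε4
  have hev := ENNReal.tendsto_nhds_zero.1 (tendsto_smoothing_of_continuous hgc hgs) (ε / 4)
    (pos_iff_ne_zero.2 hε4)
  have ih : Integrable h discMeasure := hh.integrable (by norm_num)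
  have ig : Integrable g discMeasure := hgm.integrable (by norm_num)
  filter_upwards [hev] with n hn
  have hr : 1 / 2 ≤ 1 - 2 * mollRadius n := by linarith [mollRadius_le n]
  have e : smoothing n h - h = smoothing n (h - g) + (smoothing n g - g) + (g - h) := by
    rw [smoothing, smoothing, smoothing, mollify_sub _ _ ih ig]
    abel
  have c1 : AEStronglyMeasurable (smoothing n (h - g)) discMeasure :=
    (contDiff_mollify _ _ (ih.sub ig)).continuous.aestronglyMeasurable
  have c2 : AEStronglyMeasurable (smoothing n g) discMeasure :=
    (contDiff_mollify _ _ ig).continuous.aestronglyMeasurable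
  rw [e]
  refine (eLpNorm_add_le (c1.add (c2.sub hgm.1)) (hgm.1.sub hh.1) (by norm_num)).trans ?_
  refine (add_le_add_left (eLpNorm_add_le c1 (c2.sub hgm.1) (by norm_num)) _).trans ?_
  rw [eLpNorm_sub_comm g h]
  have h1 : eLpNorm (smoothing n (h - g)) 2 discMeasure ≤ 2 * (ε / 4) :=
    (eLpNorm_mollify_le _ _ hr (hh.1.sub hgm.1)).trans (by gcongr)
  calc _ ≤ 2 * (ε / 4) + ε / 4 + ε / 4 := by gcongr
    _ = 4 * (ε / 4) := by ring
    _ = ε := ENNReal.mul_div_cancel (by simp) (by simp)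

lemma contDiff_smoothing (u : L2) (n : ℕ) : ContDiff ℝ ∞ (smoothing n u) :=
  contDiff_mollify _ _ ((Lp.memLp u).integrable (by norm_num))

lemma tendsto_smoothVal_smoothing (u : L2) :
    Tendsto (fun n => smoothVal (contDiff_smoothing u n)) atTop (𝓝 u) :=
  (tendsto_ofCont_iff (fun n => (contDiff_smoothing u n).continuous) u).1
    (tendsto_smoothing (Lp.memLp u))

lemma tendsto_smoothDeriv_smoothing {e : ℂ} {u w : L2} (huw : IsWeakDeriv e u w) :
    Tendsto (fun n => smoothDeriv (contDiff_smoothing u n) e) atTop (𝓝 w) := by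
  have h1 : ∀ n, smoothDeriv (contDiff_smoothing u n) e =
      (1 - 2 * mollRadius n : ℝ) • smoothVal (contDiff_smoothing w n) := by
    intro n
    apply Lp.ext
    have hd : ∀ᵐ z ∂discMeasure, z ∈ disc := ae_restrict_mem measurableSet_disc
    filter_upwards [coeFn_ofCont (continuous_fderiv_const (contDiff_smoothing u n) e),
      coeFn_ofCont (contDiff_smoothing w n).continuous,
      Lp.coeFn_smul (1 - 2 * mollRadius n : ℝ) (smoothVal (contDiff_smoothing w n)), hd]
      with z k1 k2 k3 hz
    rw [smoothDeriv, k1, k3, Pi.smul_apply, smoothVal, k2]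
    have h1 := mollRadius_pos n
    have h2 := mollRadius_le n
    refine fderiv_mollify_of_isWeakDeriv _ _ huw hz (by linarith) ?_
    change mollRadius n + _ ≤ 1
    linarith
  simp_rw [h1]
  have h2 : Tendsto (fun n => 1 - 2 * mollRadius n) atTop (𝓝 (1 - 2 * 0)) :=
    (tendsto_mollRadius.const_mul 2).const_sub 1
  have h3 := h2.smul (tendsto_smoothVal_smoothing w)
  simpa using h3

end Mollification

/-! ### Weighted sequences and the summed recursion. -/

section Sequences

lemma isWeakDeriv_weakDeriv {e : ℂ} {u : L2} (h : ∃ w, IsWeakDeriv e u w) :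
    IsWeakDeriv e u (weakDeriv e u) := by
  rw [weakDeriv, dif_pos h]
  exact h.choose_spec

lemma MemH1.isTrace_trace {u : L2} (hu : MemH1 u) : IsTrace u (trace u) := by
  have h : ∃ g, IsTrace u g := exists_isTrace_of_tendsto (contDiff_smoothing u)
    (tendsto_smoothVal_smoothing u)
    (tendsto_smoothDeriv_smoothing (isWeakDeriv_weakDeriv hu.1))
    (tendsto_smoothDeriv_smoothing (isWeakDeriv_weakDeriv hu.2))
  rw [trace, dif_pos h]
  exact h.choose_spec

lemma norm_sq_del_le (u : L2) : ‖del u‖ ^ 2 ≤ h1NormSq u := by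
  have h : ‖del u‖ ^ 2 + ‖delbar u‖ ^ 2 =
      (1 / 2) * (‖weakDeriv 1 u‖ ^ 2 + ‖weakDeriv Complex.I u‖ ^ 2) := norm_sq_half_add_sub _ _
  rw [h1NormSq]
  nlinarith [sq_nonneg ‖delbar u‖, sq_nonneg ‖u‖, sq_nonneg ‖weakDeriv 1 u‖,
    sq_nonneg ‖weakDeriv Complex.I u‖]

lemma norm_sq_le_h1NormSq (u : L2) : ‖u‖ ^ 2 ≤ h1NormSq u := by
  rw [h1NormSq]
  nlinarith [sq_nonneg ‖weakDeriv 1 u‖, sq_nonneg ‖weakDeriv Complex.I u‖]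

lemma weight_nonneg (p : ℝ) (j : ℕ) : 0 ≤ weight p j := by
  unfold weight
  positivity

lemma weight_zero (j : ℕ) : weight 0 j = 1 := Real.rpow_zero _

lemma weight_one (j : ℕ) : weight 1 j = 1 + (j : ℝ) ^ 2 := Real.rpow_one _

lemma weight_half (j : ℕ) : weight (1 / 2) j = √(1 + (j : ℝ) ^ 2) := (Real.sqrt_eq_rpow _).symm

lemma weight_half_sq (j : ℕ) : weight (1 / 2) j ^ 2 = weight 1 j := by
  rw [weight_half, weight_one, Real.sq_sqrt (by positivity)]

lemma one_le_weight_half (j : ℕ) : 1 ≤ weight (1 / 2) j := by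
  rw [weight_half]
  exact Real.one_le_sqrt.2 (by nlinarith [sq_nonneg (j : ℝ)])

lemma weight_half_le_weight_one (j : ℕ) : weight (1 / 2) j ≤ weight 1 j := by
  rw [← weight_half_sq]
  nlinarith [one_le_weight_half j]

/-- Source of the gradient bound: the shift by two raises the weight by a full unit. After squaring
it amounts to `2 wⱼ ≤ 4j + 3`, which follows from `wⱼ ≤ 1 + j`. -/
lemma weight_half_add_one_le (j : ℕ) : weight (1 / 2) j + 1 ≤ weight (1 / 2) (j + 2) := by
  have h1 := one_le_weight_half j
  have h2 := weight_half_sq j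
  rw [weight_one] at h2
  rw [weight_half (j + 2)]
  refine Real.le_sqrt_of_sq_le ?_
  have hj : (0 : ℝ) ≤ j := Nat.cast_nonneg j
  have h3 : weight (1 / 2) j ≤ 1 + j := by nlinarith
  push_cast
  nlinarith

lemma seqNormL2_sq (p : ℝ) (u : ℕ → L2) :
    seqNormL2 p u ^ 2 = ∑' j, weight p j * ‖u j‖ ^ 2 :=
  Real.sq_sqrt (tsum_nonneg fun j => mul_nonneg (weight_nonneg p j) (sq_nonneg _))

lemma seqNormHHalf_sq (p : ℝ) (g : ℕ → L2Circle) :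
    seqNormHHalf p g ^ 2 = ∑' j, weight p j * hHalfNormSq (g j) :=
  Real.sq_sqrt (tsum_nonneg fun j => mul_nonneg (weight_nonneg p j) (hHalfNormSq_nonneg _))

lemma MemSeqH1.memSeqHHalf {p : ℝ} {u : ℕ → L2} (hu : MemSeqH1 p u) :
    MemSeqHHalf p (traceSeq u) :=
  ⟨fun j => (hu.1 j).isTrace_trace.memHHalf, hu.2.of_nonneg_of_le
    (fun j => mul_nonneg (weight_nonneg p j) (hHalfNormSq_nonneg _))
    fun j => mul_le_mul_of_nonneg_left (hu.1 j).isTrace_trace.hHalfNormSq_le (weight_nonneg p j)⟩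

lemma MemSeqH1.memSeqL2_delSeq {p : ℝ} {u : ℕ → L2} (hu : MemSeqH1 p u) :
    MemSeqL2 p (delSeq u) :=
  hu.2.of_nonneg_of_le (fun j => mul_nonneg (weight_nonneg p j) (sq_nonneg _))
    fun j => mul_le_mul_of_nonneg_left (norm_sq_del_le _) (weight_nonneg p j)

lemma MemSeqH1.memSeqL2 {p : ℝ} {u : ℕ → L2} (hu : MemSeqH1 p u) : MemSeqL2 p u :=
  hu.2.of_nonneg_of_le (fun j => mul_nonneg (weight_nonneg p j) (sq_nonneg _))
    fun j => mul_le_mul_of_nonneg_left (norm_sq_le_h1NormSq _) (weight_nonneg p j)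

lemma MemSeqH1.zero_of_half {u : ℕ → L2} (hu : MemSeqH1 (1 / 2) u) : MemSeqH1 0 u := by
  have hn : ∀ j, 0 ≤ h1NormSq (u j) := fun j => (sq_nonneg _).trans (norm_sq_le_h1NormSq (u j))
  refine ⟨hu.1, hu.2.of_nonneg_of_le (fun j => mul_nonneg (weight_nonneg 0 j) (hn j)) fun j => ?_⟩
  rw [weight_zero]
  exact mul_le_mul_of_nonneg_right (one_le_weight_half j) (hn j)

lemma isPoincareConstant_four_pi : IsPoincareConstant (4 * Real.pi) := by
  intro u hu
  have hN := hu.memSeqHHalf.2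
  have hD : Summable fun j => weight 0 j * ‖delSeq u j‖ ^ 2 := hu.memSeqL2_delSeq
  rw [seqNormL2_sq, seqNormL2_sq, seqNormHHalf_sq, ← hD.tsum_add hN, ← tsum_mul_left]
  refine Summable.tsum_le_tsum (fun j => ?_) hu.memSeqL2 ((hD.add hN).mul_left _)
  simp only [weight_zero, one_mul]
  have h := (hu.1 j).isTrace_trace.norm_sq_le
  have hpi := Real.pi_gt_three
  change _ ≤ 4 * Real.pi * (‖del (u j)‖ ^ 2 + hHalfNormSq (trace (u j)))
  nlinarith [sq_nonneg ‖del (u j)‖]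

lemma summable_mul_of_sq {x y : ℕ → ℝ} (hx0 : ∀ j, 0 ≤ x j) (hy0 : ∀ j, 0 ≤ y j)
    (hx : Summable fun j => x j ^ 2) (hy : Summable fun j => y j ^ 2) :
    Summable fun j => x j * y j :=
  (hx.add hy).of_nonneg_of_le (fun j => mul_nonneg (hx0 j) (hy0 j)) fun j => by
    nlinarith [sq_nonneg (x j - y j), mul_nonneg (hx0 j) (hy0 j)]

lemma tsum_mul_le_sqrt {x y : ℕ → ℝ} (hx0 : ∀ j, 0 ≤ x j) (hy0 : ∀ j, 0 ≤ y j)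
    (hx : Summable fun j => x j ^ 2) (hy : Summable fun j => y j ^ 2) :
    ∑' j, x j * y j ≤ √(∑' j, x j ^ 2) * √(∑' j, y j ^ 2) := by
  have h := Real.inner_le_Lp_mul_Lq_tsum_of_nonneg Real.HolderConjugate.two_two hx0 hy0
    (by simpa using hx) (by simpa using hy)
  simpa [Real.sqrt_eq_rpow] using h

/-- Summation of the Green identities of the components of a solution. -/
lemma tsum_sq_le_of_recursion {D F N : ℕ → ℝ} (hD0 : ∀ j, 0 ≤ D j) (hF0 : ∀ j, 0 ≤ F j)
    (hD : Summable fun j => weight (1 / 2) j * D j ^ 2)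
    (hF : Summable fun j => weight 1 j * F j ^ 2)
    (hN : Summable fun j => weight (1 / 2) j * N j)
    (h : ∀ j, D j ^ 2 ≤ (F j + D (j + 2)) ^ 2 + Real.pi * N j) :
    ∑' j, D j ^ 2 ≤ ∑' j, weight 1 j * F j ^ 2 +
      2 * (√(∑' j, weight 1 j * F j ^ 2) * √(∑' j, D j ^ 2)) +
      Real.pi * ∑' j, weight (1 / 2) j * N j := by
  set w := weight (1 / 2) with hw
  have hw1 : ∀ j, 1 ≤ w j := one_le_weight_half
  have hD1 : Summable fun j => D j ^ 2 := hD.of_nonneg_of_le (fun j => sq_nonneg _) fun j =>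
    le_mul_of_one_le_left (sq_nonneg _) (hw1 j)
  have hDs : Summable fun j => D (j + 2) ^ 2 := (summable_nat_add_iff 2).2 hD1
  have hE : Summable fun j => (w j - 1) * D j ^ 2 :=
    (hD.sub hD1).congr fun j => by ring
  have hEs : Summable fun j => (w (j + 2) - 1) * D (j + 2) ^ 2 := (summable_nat_add_iff 2).2 hE
  have hF' : Summable fun j => (w j * F j) ^ 2 := hF.congr fun j => by
    rw [mul_pow, hw, weight_half_sq]
  have hwF0 : ∀ j, 0 ≤ w j * F j := fun j => mul_nonneg (zero_le_one.trans (hw1 j)) (hF0 j)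
  have hM := summable_mul_of_sq hwF0 (fun j => hD0 (j + 2)) hF' hDs
  -- The first term on the right is a shifted term of `∑ (wⱼ - 1) Dⱼ²`. As `∑ wⱼ Dⱼ²` is finite, it
  -- can be cancelled after summation, leaving `∑ Dⱼ²` on the left.
  have hstep : ∀ j, w j * D j ^ 2 ≤ (w (j + 2) - 1) * D (j + 2) ^ 2 +
      (weight 1 j * F j ^ 2 + 2 * (w j * F j * D (j + 2)) + Real.pi * (w j * N j)) := by
    intro j
    have h1 := mul_le_mul_of_nonneg_left (h j) (zero_le_one.trans (hw1 j))
    have h2 := mul_le_mul_of_nonneg_right (weight_half_add_one_le j) (sq_nonneg (D (j + 2)))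
    have h3 := mul_le_mul_of_nonneg_right (weight_half_le_weight_one j) (sq_nonneg (F j))
    rw [← hw] at h2 h3
    nlinarith
  have hR := (hF.add (hM.mul_left 2)).add (hN.mul_left Real.pi)
  have hsum := hD.tsum_le_tsum hstep (hEs.add hR)
  rw [hEs.tsum_add hR, (hF.add (hM.mul_left 2)).tsum_add (hN.mul_left Real.pi),
    hF.tsum_add (hM.mul_left 2), tsum_mul_left, tsum_mul_left] at hsum
  have hshift : ∀ x : ℕ → ℝ, (∀ j, 0 ≤ x j) → Summable x → ∑' j, x (j + 2) ≤ ∑' j, x j := by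
    intro x hx0 hx
    rw [← hx.sum_add_tsum_nat_add 2]
    exact le_add_of_nonneg_left (Finset.sum_nonneg fun j _ => hx0 j)
  have hEle := hshift (fun j => (w j - 1) * D j ^ 2)
    (fun j => mul_nonneg (sub_nonneg.2 (hw1 j)) (sq_nonneg _)) hE
  have hEeq : ∑' j, (w j - 1) * D j ^ 2 = ∑' j, w j * D j ^ 2 - ∑' j, D j ^ 2 := by
    rw [← hD.tsum_sub hD1]
    exact tsum_congr fun j => by ring
  have hDle := hshift (fun j => D j ^ 2) (fun j => sq_nonneg _) hD1
  -- The whole weight is put on `F`, so `wⱼ² = 1 + j²` matches the norm with exponent `1` and `D`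
  -- stays unweighted.
  have hC := tsum_mul_le_sqrt hwF0 (fun j => hD0 (j + 2)) hF' hDs
  have hFeq : ∑' j, (w j * F j) ^ 2 = ∑' j, weight 1 j * F j ^ 2 :=
    tsum_congr fun j => by rw [mul_pow, hw, weight_half_sq]
  rw [hFeq] at hC
  have hC' := hC.trans (mul_le_mul_of_nonneg_left (Real.sqrt_le_sqrt hDle) (Real.sqrt_nonneg _))
  beta_reduce at hEle
  linarith

/-- Completing the square gives `(2aX - b)² ≤ b² + 4ac`. -/
lemma le_root_of_quadratic {a b c X : ℝ} (ha : 0 < a) (h : a * X ^ 2 ≤ b * X + c) :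
    X ≤ (b + √(b ^ 2 + 4 * a * c)) / (2 * a) := by
  rw [le_div_iff₀ (by positivity)]
  have : 2 * a * X - b ≤ √(b ^ 2 + 4 * a * c) := by
    refine Real.le_sqrt_of_sq_le ?_
    nlinarith
  linarith

end Sequences

end BukhgeimBeltrami

end

/-! ### The gradient estimate. -/

open BukhgeimBeltrami in
theorem theorem4p3 :
    (∃ μ : ℝ, IsPoincareConstant μ) ∧
    ∀ (μ : ℝ) (_ : IsPoincareConstant μ)
      (f : ℕ → L2) (_ : MemSeqL2 1 f)
      (B : SeqL2 →ₗ[ℂ] (ℕ → L2)) (C_B : ℝ) (_ : 0 < C_B) (_ : IsSmoothingWithBound B C_B)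
      (ε : ℝ) (_ : ε = √(2 * μ) * C_B) (_ : ε < √2 - 1)
      (v : SeqL2) (_ : MemSeqH1 (1 / 2) v)
      (_ : delbarSeq v + shift (shift (delSeq v)) = B v + f)
      (a b c : ℝ)
      (_ : a = 1 - 2 * ε - ε ^ 2)
      (_ : b = 2 * ε * seqNormHHalf 0 (traceSeq v) + 2 * √2 * seqNormL2 1 f)
      (_ : c = ε ^ 2 * seqNormHHalf 0 (traceSeq v) ^ 2
        + Real.pi * seqNormHHalf (1 / 2) (traceSeq v) ^ 2 + 2 * seqNormL2 1 f ^ 2),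
      (∀ j, IsTrace (v j) (traceSeq v j)) ∧ MemSeqHHalf (1 / 2) (traceSeq v) ∧
      0 < a ∧ 0 ≤ seqNormL2 0 (delSeq v) ∧
      seqNormL2 0 (delSeq v) ≤ (b + √(b ^ 2 + 4 * a * c)) / (2 * a) := by
  refine ⟨⟨_, isPoincareConstant_four_pi⟩, ?_⟩
  intro μ hμ f hf B C hC hB ε hε hε1 v hv heq a b c ha hb hc
  have hv0 := hv.zero_of_half
  have hε0 : 0 ≤ ε := by rw [hε]; positivity
  -- `a = 2 - (1 + ε)²`, and `0 < 1 + ε < √2`.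
  have hapos : 0 < a := by
    have h2 : √2 ^ 2 = 2 := Real.sq_sqrt zero_le_two
    rw [ha]
    nlinarith
  refine ⟨fun j => (hv.1 j).isTrace_trace, hv.memSeqHHalf, hapos, Real.sqrt_nonneg _,
    le_root_of_quadratic hapos ?_⟩
  obtain ⟨hBv, hBn⟩ := hB.1 v
  -- Green's bound for each component, with `∂̄v` eliminated by the equation.
  have hrec : ∀ j, ‖del (v j)‖ ^ 2 ≤ (‖B v j + f j‖ + ‖del (v (j + 2))‖) ^ 2 +
      Real.pi * hHalfNormSq (trace (v j)) := by
    intro j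
    have h1 := (abs_le.1 (hv.1 j).isTrace_trace.abs_green_le).2
    have h2 : delbar (v j) = (B v j + f j) - del (v (j + 2)) := eq_sub_of_add_eq (congrFun heq j)
    have h3 : ‖delbar (v j)‖ ^ 2 ≤ (‖B v j + f j‖ + ‖del (v (j + 2))‖) ^ 2 := by
      rw [h2]
      exact pow_le_pow_left₀ (norm_nonneg _) (norm_sub_le _ _) 2
    linarith
  have hle : ∀ j, weight 1 j * ‖B v j + f j‖ ^ 2 ≤
      2 * (weight 1 j * ‖B v j‖ ^ 2) + 2 * (weight 1 j * ‖f j‖ ^ 2) := by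
    intro j
    have h1 : ‖B v j + f j‖ ^ 2 ≤ (‖B v j‖ + ‖f j‖) ^ 2 :=
      pow_le_pow_left₀ (norm_nonneg _) (norm_add_le _ _) 2
    have h2 := mul_le_mul_of_nonneg_left
      (h1.trans (add_sq_le (a := ‖B v j‖) (b := ‖f j‖))) (weight_nonneg 1 j)
    linarith
  have hR : Summable fun j => 2 * (weight 1 j * ‖B v j‖ ^ 2) + 2 * (weight 1 j * ‖f j‖ ^ 2) :=
    (hBv.mul_left 2).add (hf.mul_left 2)
  have hF : Summable fun j => weight 1 j * ‖B v j + f j‖ ^ 2 :=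
    hR.of_nonneg_of_le (fun j => mul_nonneg (weight_nonneg 1 j) (sq_nonneg _)) hle
  have hFle := hF.tsum_le_tsum hle hR
  rw [(hBv.mul_left 2).tsum_add (hf.mul_left 2), tsum_mul_left, tsum_mul_left,
    ← seqNormL2_sq 1 (B v), ← seqNormL2_sq 1 f] at hFle
  have key := tsum_sq_le_of_recursion (fun j => norm_nonneg _) (fun j => norm_nonneg _)
    hv.memSeqL2_delSeq hF hv.memSeqHHalf.2 hrec
  have hX : seqNormL2 0 (delSeq v) ^ 2 = ∑' j, ‖delSeq v j‖ ^ 2 := by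
    rw [seqNormL2_sq]
    exact tsum_congr fun j => by rw [weight_zero, one_mul]
  have hT := seqNormHHalf_sq (1 / 2) (traceSeq v)
  have hXn : 0 ≤ seqNormL2 0 (delSeq v) := Real.sqrt_nonneg _
  rw [← hX, ← hT, Real.sqrt_sq hXn] at key
  have hP := hμ v hv0
  set X := seqNormL2 0 (delSeq v) with hXdef
  set G := seqNormHHalf 0 (traceSeq v) with hGdef
  set T := seqNormHHalf (1 / 2) (traceSeq v)
  set f₀ := seqNormL2 1 f with hf₀def
  have hX0 : 0 ≤ X := Real.sqrt_nonneg _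
  have hG0 : 0 ≤ G := Real.sqrt_nonneg _
  have hf₀ : 0 ≤ f₀ := Real.sqrt_nonneg _
  have hBsq : 2 * seqNormL2 1 (B v) ^ 2 ≤ ε ^ 2 * (X ^ 2 + G ^ 2) := by
    have h1 : seqNormL2 1 (B v) ^ 2 ≤ (C * seqNormL2 0 v) ^ 2 :=
      pow_le_pow_left₀ (Real.sqrt_nonneg _) hBn 2
    -- The sign of `μ` is not assumed; for negative `μ` the real square root is `0` and the
    -- inequality still holds.
    have h2 : 2 * μ ≤ √(2 * μ) ^ 2 := by
      rcases le_total 0 (2 * μ) with h | h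
      · rw [Real.sq_sqrt h]
      · exact h.trans (sq_nonneg _)
    have h3 : C ^ 2 * (2 * seqNormL2 0 v ^ 2) ≤ C ^ 2 * (√(2 * μ) ^ 2 * (X ^ 2 + G ^ 2)) := by
      refine mul_le_mul_of_nonneg_left ?_ (sq_nonneg C)
      have := mul_le_mul_of_nonneg_right h2 (show 0 ≤ X ^ 2 + G ^ 2 by positivity)
      linarith
    rw [hε, mul_pow]
    linarith
  set Q2 := ∑' j, weight 1 j * ‖B v j + f j‖ ^ 2 with hQ2
  have hQ : Q2 ≤ ε ^ 2 * (X ^ 2 + G ^ 2) + 2 * f₀ ^ 2 := by linarith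
  -- This linear form of `hQ` serves the cross term `2 √Q2 X`, producing `2εX²` and `bX`; the
  -- quadratic form `hQ` produces `ε²X²` and the terms of `c` without `π`.
  have hQs : √Q2 ≤ ε * (X + G) + √2 * f₀ := by
    refine Real.sqrt_le_iff.2 ⟨by positivity, hQ.trans ?_⟩
    have h2 : √2 ^ 2 = 2 := Real.sq_sqrt zero_le_two
    have h3 : 0 ≤ ε ^ 2 * (2 * X * G) + 2 * (ε * (X + G)) * (√2 * f₀) := by positivity
    have h4 : (ε * (X + G) + √2 * f₀) ^ 2 = ε ^ 2 * (X ^ 2 + G ^ 2) + √2 ^ 2 * f₀ ^ 2 +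
      (ε ^ 2 * (2 * X * G) + 2 * (ε * (X + G)) * (√2 * f₀)) := by ring
    rw [h4, h2]
    linarith
  have hQX := mul_le_mul_of_nonneg_right hQs hX0
  rw [ha, hb, hc]
  linarith
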